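/- For every $n\in\mathbb N$ let $\mathbf d_n=((d_x^-,d_x^+))_{x\in[n]}$ be a deterministic sequence of in- and out-degrees (depending on $n$) with $m=m_n:=\sum_{x\in[n]}d_x^-=\sum_{x\in[n]}d_x^+$, and assume that there are constants $C,C'\ge 2$ such that for all $n$ and all $x\in[n]$ $$d_x^-\ge 2,\qquad d_x^+\ge 2,\qquad d_x^+\le C,\qquad d_x^-\le C'.$$ Let $G_n=([n],E)$ be the directed configuration model: attach $d_x^+$ labelled out-stubs and $d_x^-$ labelled in-stubs to every vertex $x$, match the $m$ out-stubs with the $m$ in-stubs uniformly at random, and draw for each matched pair a directed edge from the vertex of the out-stub to the vertex of the in-stub (loops and parallel edges are allowed, and edges are counted with multiplicity, so $|E|=m$). Write $\mathbb P$ for the law of $G_n$. Given $G_n$, let $(\eta_t)_{t\ge 0}$ be the voter model on $G_n$, i.e. the continuous-time Markov process on $\{0,1\}^{[n]}$ with generator $$(\mathcal L f)(\eta)=\sum_{(x,y)\in E}\frac{1}{d_x^+}\big(f(\eta^{x\to y})-f(\eta)\big),\qquad \eta^{x\to y}(z)=\begin{cases}\eta(y),& z=x,\\ \eta(z),& z\ne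 x,\end{cases}$$ and let $\mathbf E_u$ denote the expectation, for fixed $G_n$, when the initial distribution is $\eta_0\sim\mathrm{Bern}(u)^{\otimes[n]}$. Let $$\mathcal D_t=\frac{|\{(x,y)\in E:\ \eta_t(x)\ne\eta_t(y)\}|}{|E|}$$ be the density of discordant edges at time $t$. Put $\delta=\delta_n=\frac mn$, $\rho=\rho_n=\frac1m\sum_{x\in[n]}\frac{d_x^-}{d_x^+}$, let $C_s=\frac1{s+1}\binom{2s}{s}$ be the Catalan numbers, and for $t\ge 0$ let $$\varphi(t)=\varphi_n(t)=1-\frac1{2\delta}\sum_{k\ge 0}e^{-2t}\frac{(2t)^k}{k!}\left(\sum_{s=1}^{\lfloor (k-1)/2\rfloor}2^{-2s}\,C_s\,\rho^s\,\mathbf 1_{k>2}+\mathbf 1_{k>0}\right).$$ **Proposition.** Fix $u\in(0,1)$. For every non-negative real sequence $(t_n)_{n\in\mathbb N}$ such that $\lim_{n\to\infty}t_n$ exists in $[0,\infty]$ and $t_n=o(\log^3 n)$, $$\Big|\mathbf E_u[\mathcal D_{t_n}]-2u(1-u)\,\varphi_n(t_n)\Big|\ \xrightarrow{\ \mathbb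 P\ }\ 0\qquad(n\to\infty),$$ that is, for every $\varepsilon>0$, $\mathbb P\big(\big|\mathbf E_u[\mathcal D_{t_n}]-2u(1-u)\varphi_n(t_n)\big|>\varepsilon\big)\to 0$. -/

import Mathlib

open MeasureTheory ProbabilityTheory Filter Topology Asymptotics

noncomputable section

/-! ### Directed multigraphs and the voter model -/

/-- A directed multigraph on the vertex type `V` with edges labelled by `E`
(loops and parallel edges are allowed); `e` is directed from `src e` to `dst e`. -/
structure DirectedMultigraph (V E : Type) where
  src : E → V
  dst : E → V

namespace DirectedMultigraph

variable {V E : Type} [Fintype V] [DecidableEq V] [Fintype E] (G : DirectedMultigraph V E)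

/-- The out-degree `d_x⁺`: the number of edges leaving `x`, counted with multiplicity. -/
def outDegree (x : V) : ℕ := (Finset.univ.filter fun e : E => G.src e = x).card

/-- The configuration `η^{x → y}`, in which `x` has adopted the opinion of `y`. -/
def adopt (η : V → Bool) (x y : V) : V → Bool := Function.update η x (η y)

/-- The infinitesimal generator of the voter model:
`(L f)(η) = ∑_{(x,y) ∈ E} (1 / d_x⁺) (f(η^{x → y}) - f(η))`. -/
def voterGenerator : ((V → Bool) → ℝ) →ₗ[ℝ] ((V → Bool) → ℝ) where
  toFun f η := ∑ e : E,
    1 / (G.outDegree (G.src e) : ℝ) * (f (adopt η (G.src e) (G.dst e)) - f η)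
  map_add' f g := by
    funext η
    simp only [Pi.add_apply, ← Finset.sum_add_distrib]
    exact Finset.sum_congr rfl fun e _ => by ring
  map_smul' c f := by
    funext η
    simp only [Pi.smul_apply, smul_eq_mul, RingHom.id_apply, Finset.mul_sum]
    exact Finset.sum_congr rfl fun e _ => by ring

/-- The transition semigroup `exp (t L)` of the voter model: `(exp (t L) f)(η)` is the expectation
of `f(η_t)` for the continuous-time Markov process with generator `L` started from `η`. -/
def voterSemigroup (t : ℝ) : ((V → Bool) → ℝ) →L[ℝ] ((V → Bool) → ℝ) :=
  NormedSpace.exp (t • LinearMap.toContinuousLinearMap G.voterGenerator)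

/-- `E_u[f(η_t)]` for the voter model with initial distribution `Bern(u)^{⊗ V}`. -/
def voterExpectation (u : unitInterval) (t : ℝ) (f : (V → Bool) → ℝ) : ℝ :=
  ∫ η, G.voterSemigroup t f η ∂(Measure.pi fun _ : V => bernoulliMeasure true false u)

/-- The set of discordant edges of the configuration `η`. -/
def discordantEdges (η : V → Bool) : Finset E :=
  Finset.univ.filter fun e : E => η (G.src e) ≠ η (G.dst e)

/-- The density of discordant edges, `|D| / |E|`. -/
def discordantDensity (η : V → Bool) : ℝ :=
  ((G.discordantEdges η).card : ℝ) / (Fintype.card E : ℝ)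

end DirectedMultigraph

/-! ### The directed configuration model -/

/-- A bi-degree sequence on `n` vertices with equal total in- and out-degree. -/
structure BiDegreeSequence (n : ℕ) where
  inDeg : Fin n → ℕ
  outDeg : Fin n → ℕ
  balanced : ∑ x, inDeg x = ∑ x, outDeg x

namespace BiDegreeSequence

variable {n : ℕ} (d : BiDegreeSequence n)

/-- The number of edges `m`. -/
def numEdges : ℕ := ∑ x, d.outDeg x

/-- The out-stubs (tails): `d_x⁺` labelled ones at each vertex `x`. -/
abbrev OutStub : Type := Σ x : Fin n, Fin (d.outDeg x)

/-- The in-stubs (heads): `d_x⁻` labelled ones at each vertex `x`. -/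
abbrev InStub : Type := Σ x : Fin n, Fin (d.inDeg x)

/-- A configuration: a complete matching of out-stubs with in-stubs. -/
abbrev Configuration : Type := d.OutStub ≃ d.InStub

instance : Nonempty d.Configuration :=
  ⟨Fintype.equivOfCardEq (by simp [d.balanced])⟩

instance : MeasurableSpace d.Configuration := ⊤

/-- The multigraph of a configuration: the out-stub `e` matched with the in-stub `ω e` gives an
edge from the vertex of `e` to the vertex of `ω e`. -/
def graph (ω : d.Configuration) : DirectedMultigraph (Fin n) d.OutStub where
  src e := e.1
  dst e := (ω e).1

/-- The law of the directed configuration model: a uniformly random matching. -/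
def dcm : Measure d.Configuration := (PMF.uniformOfFintype d.Configuration).toMeasure

/-- `δ = m / n`. -/
def delta : ℝ := (d.numEdges : ℝ) / n

/-- `ρ = (1 / m) ∑_x d_x⁻ / d_x⁺`. -/
def rho : ℝ := 1 / (d.numEdges : ℝ) * ∑ x, (d.inDeg x : ℝ) / (d.outDeg x : ℝ)

/-- The function `φ`; note that `catalan s` is the Catalan number `C_s`, and that for `k = 0` the
range of summation of the inner sum is empty. -/
def phi (t : ℝ) : ℝ :=
  1 - 1 / (2 * d.delta) * ∑' k : ℕ, Real.exp (-2 * t) * ((2 * t) ^ k / (k.factorial : ℝ)) *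
    ((∑ s ∈ Finset.Icc 1 ((k - 1) / 2),
        ((2 : ℝ) ^ (2 * s))⁻¹ * (catalan s : ℝ) * d.rho ^ s * (if 2 < k then 1 else 0)) +
      (if 0 < k then 1 else 0))

end BiDegreeSequence

/-- The assumption on the degree sequences: all degrees are at least two, and the out- and
in-degrees are bounded by constants that do not depend on `n`. -/
def DegreeAssumption (d : (n : ℕ) → BiDegreeSequence n) : Prop :=
  ∃ C C' : ℝ, 2 ≤ C ∧ 2 ≤ C' ∧ ∀ (n : ℕ) (x : Fin n),
    2 ≤ (d n).inDeg x ∧ 2 ≤ (d n).outDeg x ∧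
      ((d n).outDeg x : ℝ) ≤ C ∧ ((d n).inDeg x : ℝ) ≤ C'

end

/-!
The voter model is dual to coalescing random walks: an edge is discordant at time `t` iff the two
walkers started from its ends have not met by time `t` and sit on vertices with different initial
opinions. Since together they make a Poisson number of steps of mean `2 t`, the expected density of
discordant edges is `2 u (1 - u) ∑ₖ P(Poisson(2 t) = k) (1 - qₖ)`, where `qₖ` (`edgeMeetProb`) is
the probability that the walkers from the ends of a uniformly random edge meet within `k` steps in
total (`hasSum_voterExpectation_discordantDensity`). No mixing argument is needed, as the function
`φ` has the same form, with `qₖ` replaced by `limitMeetProb`, and the two are compared directly.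

If the edges traversed by the walkers form a tree rooted at the starting point of the first walker
(`IsTreelike`), then a walk is determined by its endpoint, so that the walkers meet exactly when the
first one has made the same walk as the second one, the initial edge included. Hence `qₖ` differs
from the probability that the first walker catches up in this way by at most the probability
`edgeCollideProb` that the tree property fails (`abs_meetProb_sub_followProb_le`). The former can be
computed exactly in any graph: catching up after `2 j + 1` steps can be timed in `catalan j` ways,
and given the timing it has the probability `edgeBranchMean j / 2 ^ (2 j + 1)` (`followProb_append`,
`abs_edgeMeetProb_sub_le`).

The rest is an average over the matching, whose values are revealed one at a time. A new edge is
nearly uniformly distributed (`abs_sum_matchingCylinder_le`,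
`abs_sum_matchingCylinder_apply_sub_le`), so that

* the tree property fails within `k` steps with probability `O((k + 1)² / m)`
  (`average_edgeCollideProb_le`), which is `O((1 + t)² / m) = o(1)` after averaging over the Poisson
  number of steps;
* two walks from different edges see independent in-degree-biased vertices up to an error
  `O(1 / m)`, whence `edgeBranchMean j → ρ ^ j / δ` in mean square
  (`average_edgeBranchMean_sub_sq_le`).

Finally, all out-degrees being at least two, catching up after more than `2 S` steps has probability
at most `2 / 2 ^ S` in every graph, so only finitely many `j` matter.
-/

noncomputable section

/-! ### Poisson weights and their moments -/

/-- The weight of `k` under the Poisson law of mean `2 t`. -/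
def poissonWeight (t : ℝ) (k : ℕ) : ℝ :=
  Real.exp (-2 * t) * ((2 * t) ^ k / (k.factorial : ℝ))

lemma poissonWeight_nonneg {t : ℝ} (ht : 0 ≤ t) (k : ℕ) : 0 ≤ poissonWeight t k := by
  unfold poissonWeight
  positivity

lemma hasSum_poissonWeight (t : ℝ) : HasSum (poissonWeight t) 1 := by
  have h := (NormedSpace.expSeries_div_hasSum_exp (2 * t)).mul_left (Real.exp (-2 * t))
  rw [← Real.exp_eq_exp_ℝ, ← Real.exp_add, neg_mul, neg_add_cancel, Real.exp_zero] at h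
  exact h.congr_fun fun k => by rw [poissonWeight, neg_mul]

lemma hasSum_poissonWeight_mul_nat_mul {t a : ℝ} {g : ℕ → ℝ}
    (h : HasSum (fun k => poissonWeight t k * g (k + 1)) a) :
    HasSum (fun k : ℕ => poissonWeight t k * (k * g k)) (2 * t * a) := by
  rw [← hasSum_nat_add_iff' 1]
  simp only [Finset.range_one, Finset.sum_singleton, Nat.cast_zero, zero_mul, mul_zero, sub_zero]
  refine (h.mul_left (2 * t)).congr_fun fun k => ?_
  have : ((k : ℝ) + 1) ≠ 0 := by positivity
  simp only [poissonWeight, Nat.factorial_succ]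
  push_cast
  field_simp
  ring

lemma hasSum_poissonWeight_mul_sq (t : ℝ) :
    HasSum (fun k : ℕ => poissonWeight t k * ((k : ℝ) + 1) ^ 2) (4 * t ^ 2 + 6 * t + 1) := by
  have h0 := hasSum_poissonWeight t
  have h1 := hasSum_poissonWeight_mul_nat_mul (t := t) (g := fun _ => 1) (by simpa using h0)
  have h2 := hasSum_poissonWeight_mul_nat_mul (t := t) (g := fun k => (k : ℝ))
    ((h1.add h0).congr_fun fun k => by push_cast; ring)
  have h3 := ((h2.add (h1.mul_left 2)).add h0)
  convert h3.congr_fun (g := fun k : ℕ => poissonWeight t k * ((k : ℝ) + 1) ^ 2) ?_ using 1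
  · ring
  · intro k
    ring

/-! ### Ballot numbers -/

/-- The coefficients of the `l`-th power of the generating function of the Catalan numbers. They
count the ways in which a simple random walk started from `l` can first reach `0` with `j` steps
up and `l + j` steps down. -/
def ballotNumber (l j : ℕ) : ℕ := PowerSeries.coeff j (PowerSeries.catalanSeries ^ l)

lemma ballotNumber_zero_left (j : ℕ) : ballotNumber 0 j = if j = 0 then 1 else 0 := by
  simp [ballotNumber, PowerSeries.coeff_one]

lemma ballotNumber_one_left (j : ℕ) : ballotNumber 1 j = catalan j := by
  simp [ballotNumber]

lemma ballotNumber_zero_right (l : ℕ) : ballotNumber l 0 = 1 := by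
  simp [ballotNumber]

lemma ballotNumber_succ (l j : ℕ) :
    ballotNumber (l + 1) (j + 1) = ballotNumber l (j + 1) + ballotNumber (l + 2) j := by
  have h : PowerSeries.catalanSeries ^ (l + 1) =
      PowerSeries.catalanSeries ^ l + PowerSeries.catalanSeries ^ (l + 2) * PowerSeries.X := by
    calc PowerSeries.catalanSeries ^ (l + 1)
        = PowerSeries.catalanSeries ^ l *
          (PowerSeries.catalanSeries ^ 2 * PowerSeries.X + 1) := by
          rw [PowerSeries.catalanSeries_sq_mul_X_add_one, pow_succ]
      _ = _ := by ring
  rw [ballotNumber, h, map_add, PowerSeries.coeff_succ_mul_X, ballotNumber, ballotNumber]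

lemma catalan_le_four_pow (j : ℕ) : catalan j ≤ 4 ^ j := by
  rw [catalan_eq_centralBinom_div]
  refine (Nat.div_le_self _ _).trans ?_
  rw [Nat.centralBinom_eq_two_mul_choose, show (4 : ℕ) = 2 ^ 2 by rfl, ← pow_mul]
  exact Nat.choose_le_two_pow _ _

namespace DirectedMultigraph

variable {V E : Type} [DecidableEq V] [Fintype E] (G : DirectedMultigraph V E)

/-! ### Averages over the edges leaving a vertex -/

/-- The mean of `f` over the edges leaving `x`, that is, over one step of the random walk from
`x`. It is zero if no edge leaves `x`. -/
def stepMean (f : E → ℝ) (x : V) : ℝ :=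
  1 / (G.outDegree x : ℝ) * ∑ e with G.src e = x, f e

lemma stepMean_sub (f g : E → ℝ) (x : V) :
    G.stepMean (fun e => f e - g e) x = G.stepMean f x - G.stepMean g x := by
  simp only [stepMean, Finset.sum_sub_distrib, mul_sub]

lemma stepMean_const_mul (c : ℝ) (f : E → ℝ) (x : V) :
    G.stepMean (fun e => c * f e) x = c * G.stepMean f x := by
  simp only [stepMean, ← Finset.mul_sum]
  ring

lemma stepMean_sum {ι : Type} (s : Finset ι) (f : ι → E → ℝ) (x : V) :
    G.stepMean (fun e => ∑ i ∈ s, f i e) x = ∑ i ∈ s, G.stepMean (f i) x := by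
  simp only [stepMean, Finset.mul_sum]
  rw [Finset.sum_comm]

lemma stepMean_const {x : V} (hx : 0 < G.outDegree x) (c : ℝ) :
    G.stepMean (fun _ => c) x = c := by
  have : (G.outDegree x : ℝ) ≠ 0 := by positivity
  simp only [stepMean, Finset.sum_const, nsmul_eq_mul]
  change 1 / (G.outDegree x : ℝ) * ((G.outDegree x : ℝ) * c) = c
  field_simp

lemma stepMean_congr {f g : E → ℝ} {x : V} (h : ∀ e, G.src e = x → f e = g e) :
    G.stepMean f x = G.stepMean g x := by
  unfold stepMean
  congr 1
  exact Finset.sum_congr rfl fun e he => h e (Finset.mem_filter.1 he).2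

lemma stepMean_mono {f g : E → ℝ} {x : V} (h : ∀ e, G.src e = x → f e ≤ g e) :
    G.stepMean f x ≤ G.stepMean g x := by
  unfold stepMean
  gcongr with e he
  exact h e (Finset.mem_filter.1 he).2

lemma stepMean_nonneg {f : E → ℝ} {x : V} (h : ∀ e, G.src e = x → 0 ≤ f e) :
    0 ≤ G.stepMean f x :=
  mul_nonneg (by positivity) (Finset.sum_nonneg fun e he => h e (Finset.mem_filter.1 he).2)

lemma stepMean_le {f : E → ℝ} {x : V} (hx : 0 < G.outDegree x) {c : ℝ}
    (h : ∀ e, G.src e = x → f e ≤ c) : G.stepMean f x ≤ c :=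
  (G.stepMean_mono h).trans_eq (G.stepMean_const hx c)

lemma abs_stepMean_sub_le {f g h : E → ℝ} {x : V}
    (hfg : ∀ e, G.src e = x → |f e - g e| ≤ h e) :
    |G.stepMean f x - G.stepMean g x| ≤ G.stepMean h x := by
  rw [← stepMean_sub, abs_le]
  constructor
  · have := G.stepMean_mono (f := fun e => (-1) * h e) (g := fun e => f e - g e) (x := x)
      fun e he => by linarith [(abs_le.1 (hfg e he)).1]
    rw [stepMean_const_mul] at this
    linarith
  · exact G.stepMean_mono fun e he => (abs_le.1 (hfg e he)).2

/-! ### Duality with a pair of random walks -/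

/-- The discrete-time evolution of a function `F` of a pair of vertices: the expectation of
`F` after `k` steps of the chain in which one of the two walkers, chosen with probability `1 / 2`
each, makes a random-walk step, and which stops when the walkers meet. -/
def pairEvolve (F : V → V → ℝ) : ℕ → V → V → ℝ
  | 0, a, b => F a b
  | k + 1, a, b => if a = b then F a b else
      (G.stepMean (fun e => pairEvolve F k (G.dst e) b) a +
        G.stepMean (fun e => pairEvolve F k a (G.dst e)) b) / 2

/-- The probability that two walkers started from `a` and `b` meet within `k` steps in total. -/
def meetProb : ℕ → V → V → ℝ := G.pairEvolve fun a b => if a = b then 1 else 0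

/-- The indicator that `a` and `b` have different opinions. -/
def discord (η : V → Bool) (a b : V) : ℝ := if η a ≠ η b then 1 else 0

lemma pairEvolve_self (F : V → V → ℝ) (k : ℕ) (a : V) : G.pairEvolve F k a a = F a a := by
  cases k <;> simp [pairEvolve]

lemma pairEvolve_succ_of_ne (F : V → V → ℝ) (k : ℕ) {a b : V} (hab : a ≠ b) :
    G.pairEvolve F (k + 1) a b = (G.stepMean (fun e => G.pairEvolve F k (G.dst e) b) a +
        G.stepMean (fun e => G.pairEvolve F k a (G.dst e)) b) / 2 := by
  simp [pairEvolve, hab]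

lemma voterGenerator_discord (hG : ∀ x, 0 < G.outDegree x) (a b : V) :
    G.voterGenerator (fun η => discord η a b) =
      fun η => 2 * (G.pairEvolve (discord η) 1 a b - discord η a b) := by
  funext η
  by_cases hab : a = b
  · subst hab
    simp [voterGenerator, pairEvolve, discord]
  -- only the edges leaving `a` or `b` contribute
  have key : ∀ e : E, 1 / (G.outDegree (G.src e) : ℝ) *
      (discord (adopt η (G.src e) (G.dst e)) a b - discord η a b) =
      (if G.src e = a then 1 / (G.outDegree a : ℝ) *
          (discord η (G.dst e) b - discord η a b) else 0) +
      (if G.src e = b then 1 / (G.outDegree b : ℝ) *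
          (discord η a (G.dst e) - discord η a b) else 0) := by
    intro e
    by_cases ha : G.src e = a
    · have hb : G.src e ≠ b := fun h => hab (ha.symm.trans h)
      simp [ha, hab, discord, adopt, Function.update, Ne.symm hab]
    · by_cases hb : G.src e = b
      · simp [hb, Ne.symm hab, discord, adopt, Function.update, hab]
      · simp [ha, hb, discord, adopt, Function.update, Ne.symm ha, Ne.symm hb]
  have hmean : ∀ (f : E → ℝ) (x : V) (c : ℝ),
      (∑ e : E, if G.src e = x then 1 / (G.outDegree x : ℝ) * (f e - c) else 0) =
        G.stepMean f x - c := by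
    intro f x c
    rw [← Finset.sum_filter, ← Finset.mul_sum]
    change G.stepMean (fun e => f e - c) x = _
    rw [stepMean_sub, stepMean_const G (hG x)]
  change ∑ e : E, _ = _
  rw [Finset.sum_congr rfl fun e _ => key e, Finset.sum_add_distrib, hmean, hmean,
    pairEvolve_succ_of_ne G _ _ hab]
  simp only [pairEvolve]
  ring

/-- Kolmogorov's equation for the evolution of a single discordance: on the functions
`pairEvolve (discord ·) k a b` the generator acts as twice the forward difference in `k`. -/
lemma voterGenerator_pairEvolve (hG : ∀ x, 0 < G.outDegree x) (k : ℕ) (a b : V) :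
    G.voterGenerator (fun η => G.pairEvolve (discord η) k a b) =
      fun η => 2 * (G.pairEvolve (discord η) (k + 1) a b - G.pairEvolve (discord η) k a b) := by
  induction k generalizing a b with
  | zero => exact G.voterGenerator_discord hG a b
  | succ k ih =>
    by_cases hab : a = b
    · subst hab
      simp only [pairEvolve_self]
      rw [show (fun η : V → Bool => discord η a a) = 0 by funext η; simp [discord], map_zero]
      funext η
      simp
    have hfun : (fun η => G.pairEvolve (discord η) (k + 1) a b) =
        (1 / 2 : ℝ) • ((1 / (G.outDegree a : ℝ)) • ∑ e with G.src e = a,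
            (fun η => G.pairEvolve (discord η) k (G.dst e) b) +
          (1 / (G.outDegree b : ℝ)) • ∑ e with G.src e = b,
            fun η => G.pairEvolve (discord η) k a (G.dst e)) := by
      funext η
      rw [pairEvolve_succ_of_ne G _ _ hab]
      simp only [stepMean, Pi.smul_apply, Pi.add_apply, Finset.sum_apply, smul_eq_mul]
      ring
    rw [hfun, map_smul, map_add, map_smul, map_smul, map_sum, map_sum]
    simp only [ih]
    funext η
    rw [pairEvolve_succ_of_ne G _ _ hab, pairEvolve_succ_of_ne G _ _ hab]
    simp only [stepMean, Pi.smul_apply, Pi.add_apply, Finset.sum_apply, smul_eq_mul,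
      ← Finset.mul_sum, Finset.sum_sub_distrib]
    ring

/-- The two walkers together make a Poisson number of steps of mean `2 t` by time `t`. -/
lemma hasSum_voterSemigroup_discord [Fintype V] (hG : ∀ x, 0 < G.outDegree x) (t : ℝ) (a b : V)
    (η : V → Bool) :
    HasSum (fun k => poissonWeight t k * G.pairEvolve (discord η) k a b)
      (G.voterSemigroup t (fun η => discord η a b) η) := by
  set L := LinearMap.toContinuousLinearMap G.voterGenerator with hL
  -- `S / 2` shifts the sequence of functions `pairEvolve (discord ·) k a b` by one
  let S : ((V → Bool) → ℝ) →L[ℝ] ((V → Bool) → ℝ) := L + (2 : ℝ) • 1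
  have hS : ∀ k, S (fun η => G.pairEvolve (discord η) k a b) =
      (2 : ℝ) • fun η => G.pairEvolve (discord η) (k + 1) a b := by
    intro k
    have h1 : L (fun η => G.pairEvolve (discord η) k a b) = _ :=
      G.voterGenerator_pairEvolve hG k a b
    change L _ + (2 : ℝ) • (fun η => G.pairEvolve (discord η) k a b) = _
    rw [h1]
    funext η
    simp only [Pi.add_apply, Pi.smul_apply, smul_eq_mul]
    ring
  have hSpow : ∀ k, (S ^ k) (fun η => discord η a b) =
      (2 : ℝ) ^ k • fun η => G.pairEvolve (discord η) k a b := by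
    intro k
    induction k with
    | zero => simp [pairEvolve]
    | succ k ih =>
      rw [pow_succ', mul_apply_eq_comp, ih, map_smul, hS, smul_smul, pow_succ]
  let : NormedAlgebra ℚ (((V → Bool) → ℝ) →L[ℝ] ((V → Bool) → ℝ)) := .restrictScalars ℚ ℝ _
  have hexp : G.voterSemigroup t = Real.exp (-2 * t) • NormedSpace.exp (t • S) := by
    have h0 : t • L = algebraMap ℝ (((V → Bool) → ℝ) →L[ℝ] ((V → Bool) → ℝ)) (-2 * t) + t • S := by
      rw [Algebra.algebraMap_eq_smul_one, smul_add, smul_smul, mul_comm t 2, ← add_assoc,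
        add_right_comm, ← add_smul]
      simp
    rw [voterSemigroup, ← hL, h0, NormedSpace.exp_add_of_commute (Algebra.commutes _ _),
      ← NormedSpace.algebraMap_exp_comm, ← Real.exp_eq_exp_ℝ,
      Algebra.algebraMap_eq_smul_one, smul_mul_assoc, one_mul]
  have h := ((ContinuousLinearMap.proj (R := ℝ) (φ := fun _ : V → Bool => ℝ) η).comp
    (ContinuousLinearMap.apply ℝ ((V → Bool) → ℝ) (fun η => discord η a b))).hasSum
      (NormedSpace.exp_series_hasSum_exp' (𝕂 := ℝ) (t • S)) |>.mul_left (Real.exp (-2 * t))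
  rw [hexp]
  refine HasSum.congr_fun h fun k => ?_
  simp only [ContinuousLinearMap.comp_apply, ContinuousLinearMap.apply_apply,
    ContinuousLinearMap.proj_apply, smul_pow, smul_apply, hSpow,
    Pi.smul_apply, smul_eq_mul, poissonWeight, mul_pow]
  ring

lemma integral_discord {W : Type} [Fintype W] (u : unitInterval) {a b : W} (hab : a ≠ b) :
    ∫ η, discord η a b ∂(Measure.pi fun _ : W => bernoulliMeasure true false u) =
      2 * (u : ℝ) * (1 - u) := by
  set μ := Measure.pi fun _ : W => bernoulliMeasure true false u
  let X : W → (W → Bool) → ℝ := fun x η => if η x then 1 else 0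
  have hX : ∀ x, ∫ η, X x η ∂μ = u := by
    intro x
    have := (measurePreserving_eval (fun _ : W => bernoulliMeasure true false u) x).map_eq
    have h2 := integral_map (μ := μ) (φ := Function.eval x)
      (f := fun c : Bool => if c then (1 : ℝ) else 0)
      (measurable_pi_apply x).aemeasurable (by fun_prop)
    rw [this, integral_bernoulliMeasure] at h2
    simpa using h2.symm
  have hind : IndepFun (X a) (X b) μ :=
    (iIndepFun_pi (μ := fun _ : W => bernoulliMeasure true false u)
      (X := fun _ (c : Bool) => if c then (1 : ℝ) else 0) fun _ => by fun_prop).indepFun hab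
  have hprod : ∫ η, (X a * X b) η ∂μ = (u : ℝ) * u := by
    rw [hind.integral_mul_eq_mul_integral (by fun_prop) (by fun_prop), hX, hX]
  have hd : ∀ η, discord η a b = X a η + X b η - 2 * (X a * X b) η := by
    intro η
    simp only [discord, X, Pi.mul_apply]
    cases η a <;> cases η b <;> norm_num
  simp_rw [hd]
  rw [integral_sub (.of_finite) (.of_finite), integral_add (.of_finite) (.of_finite),
    integral_const_mul, hprod, hX, hX]
  ring

lemma integral_pairEvolve_discord [Fintype V] (hG : ∀ x, 0 < G.outDegree x) (u : unitInterval)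
    (k : ℕ) (a b : V) :
    ∫ η, G.pairEvolve (discord η) k a b
        ∂(Measure.pi fun _ : V => bernoulliMeasure true false u) =
      2 * (u : ℝ) * (1 - u) * (1 - G.meetProb k a b) := by
  induction k generalizing a b with
  | zero =>
    by_cases hab : a = b
    · simp [meetProb, pairEvolve, discord, hab]
    · simpa [meetProb, pairEvolve, hab] using integral_discord u hab
  | succ k ih =>
    by_cases hab : a = b
    · simp [meetProb, pairEvolve, discord, hab]
    simp_rw [meetProb, pairEvolve_succ_of_ne G _ _ hab, stepMean]
    rw [integral_div, integral_add (.of_finite) (.of_finite), integral_const_mul,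
      integral_const_mul, integral_finsetSum _ fun _ _ => .of_finite,
      integral_finsetSum _ fun _ _ => .of_finite]
    simp_rw [ih]
    have h1 := G.stepMean_const_mul (2 * (u : ℝ) * (1 - u))
      (fun e => 1 - G.meetProb k (G.dst e) b) a
    have h2 := G.stepMean_const_mul (2 * (u : ℝ) * (1 - u))
      (fun e => 1 - G.meetProb k a (G.dst e)) b
    rw [stepMean_sub, stepMean_const G (hG _)] at h1 h2
    simp only [stepMean] at h1 h2
    rw [h1, h2]
    simp only [meetProb]
    ring

lemma pairEvolve_mem_Icc (hG : ∀ x, 0 < G.outDegree x) {F : V → V → ℝ}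
    (hF : ∀ a b, F a b ∈ Set.Icc (0 : ℝ) 1) (k : ℕ) (a b : V) :
    G.pairEvolve F k a b ∈ Set.Icc (0 : ℝ) 1 := by
  induction k generalizing a b with
  | zero => exact hF a b
  | succ k ih =>
    unfold pairEvolve
    split_ifs with hab
    · exact hF a b
    have h1 := G.stepMean_nonneg (x := a) fun e _ => (ih (G.dst e) b).1
    have h2 := G.stepMean_nonneg (x := b) fun e _ => (ih a (G.dst e)).1
    have h3 := G.stepMean_le (hG a) fun e _ => (ih (G.dst e) b).2
    have h4 := G.stepMean_le (hG b) fun e _ => (ih a (G.dst e)).2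
    exact ⟨by linarith, by linarith⟩

lemma meetProb_mem_Icc (hG : ∀ x, 0 < G.outDegree x) (k : ℕ) (a b : V) :
    G.meetProb k a b ∈ Set.Icc (0 : ℝ) 1 :=
  G.pairEvolve_mem_Icc hG (fun a b => by split_ifs <;> simp) k a b

/-- The probability that the walkers started from the two ends of a uniformly random edge meet
within `k` steps. -/
def edgeMeetProb (k : ℕ) : ℝ :=
  1 / (Fintype.card E : ℝ) * ∑ e : E, G.meetProb k (G.src e) (G.dst e)

lemma edgeMeetProb_mem_Icc (hG : ∀ x, 0 < G.outDegree x) (k : ℕ) :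
    G.edgeMeetProb k ∈ Set.Icc (0 : ℝ) 1 := by
  unfold edgeMeetProb
  constructor
  · exact mul_nonneg (by positivity)
      (Finset.sum_nonneg fun e _ => (G.meetProb_mem_Icc hG k _ _).1)
  · rw [one_div, inv_mul_eq_div]
    refine div_le_one_of_le₀ ?_ (by positivity)
    refine (Finset.sum_le_card_nsmul _ _ 1 fun e _ => (G.meetProb_mem_Icc hG k _ _).2).trans ?_
    simp

/-- Duality: an edge is discordant at time `t` iff the walkers started from its two ends, run for
a time `t`, have not met and are sitting on vertices with different initial opinions. -/
lemma hasSum_voterExpectation_discordantDensity [Fintype V] [Nonempty E]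
    (hG : ∀ x, 0 < G.outDegree x)
    (u : unitInterval) {t : ℝ} (ht : 0 ≤ t) :
    HasSum (fun k => poissonWeight t k * (2 * (u : ℝ) * (1 - u) * (1 - G.edgeMeetProb k)))
      (G.voterExpectation u t G.discordantDensity) := by
  have hint := fun k a b => G.integral_pairEvolve_discord hG u k a b
  set μ := Measure.pi fun _ : V => bernoulliMeasure true false u with hμ
  have hE : (Fintype.card E : ℝ) ≠ 0 := by positivity
  have hdens : G.discordantDensity =
      (1 / (Fintype.card E : ℝ)) • ∑ e : E, fun η => discord η (G.src e) (G.dst e) := by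
    funext η
    simp only [discordantDensity, discordantEdges, Pi.smul_apply, Finset.sum_apply, discord,
      Finset.sum_boole, smul_eq_mul]
    ring
  have hedge : ∀ e : E, HasSum (fun k => poissonWeight t k *
      (2 * (u : ℝ) * (1 - u) * (1 - G.meetProb k (G.src e) (G.dst e))))
      (∫ η, G.voterSemigroup t (fun η => discord η (G.src e) (G.dst e)) η ∂μ) := by
    intro e
    have h0 : ∀ (k : ℕ) (η : V → Bool),
        G.pairEvolve (discord η) k (G.src e) (G.dst e) ∈ Set.Icc (0 : ℝ) 1 := fun k η =>
      G.pairEvolve_mem_Icc hG (fun a b => by unfold discord; split_ifs <;> simp) k _ _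
    have h := hasSum_integral_of_summable_integral_norm (μ := μ)
      (F := fun k η => poissonWeight t k * G.pairEvolve (discord η) k (G.src e) (G.dst e))
      (fun _ => .of_finite) ?_
    · simp only [integral_const_mul, hint,
        (G.hasSum_voterSemigroup_discord hG t _ _ _).tsum_eq] at h
      exact h
    · refine Summable.of_nonneg_of_le (fun k => integral_nonneg fun η => norm_nonneg _)
        (fun k => ?_) (hasSum_poissonWeight t).summable
      refine (integral_mono (.of_finite) (integrable_const (poissonWeight t k))
        fun η => ?_).trans_eq (by simp)
      have := h0 k η
      rw [Real.norm_eq_abs, abs_of_nonneg (mul_nonneg (poissonWeight_nonneg ht k) this.1)]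
      exact mul_le_of_le_one_right (poissonWeight_nonneg ht k) this.2
  have h := (hasSum_sum fun e (_ : e ∈ Finset.univ) => hedge e).mul_left (1 / (Fintype.card E : ℝ))
  have hval : G.voterExpectation u t G.discordantDensity = 1 / (Fintype.card E : ℝ) *
      ∑ e : E, ∫ η, G.voterSemigroup t (fun η => discord η (G.src e) (G.dst e)) η ∂μ := by
    unfold voterExpectation
    rw [← hμ, hdens, map_smul, map_sum]
    simp only [Pi.smul_apply, Finset.sum_apply, smul_eq_mul]
    rw [integral_const_mul, integral_finsetSum _ fun _ _ => .of_finite]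
  rw [hval]
  refine HasSum.congr_fun h fun k => ?_
  simp only [← Finset.mul_sum, Finset.sum_sub_distrib, edgeMeetProb]
  simp only [Finset.sum_const, Finset.card_univ, nsmul_eq_mul, mul_one]
  field_simp

/-! ### Two walkers exploring a tree -/

/-- The vertex at which the walk from `x₀` along the edges of a list ends. The last edge of the
walk is the head of the list. -/
def endpoint (x₀ : V) : List E → V
  | [] => x₀
  | e :: _ => G.dst e

/-- The list, read backwards, is the sequence of edges of a walk from `x₀`. -/
def IsWalk (x₀ : V) : List E → Prop
  | [] => True
  | e :: α => G.src e = G.endpoint x₀ α ∧ IsWalk x₀ α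

/-- The edges of the two walks `α` and `β` from `x₀` form a tree rooted at `x₀`: no two of them
have the same head, and none leads back to `x₀`. -/
def IsTreelike (x₀ : V) (α β : List E) : Prop :=
  (∀ e ∈ α ++ β, G.dst e ≠ x₀) ∧ ∀ e ∈ α ++ β, ∀ e' ∈ α ++ β, G.dst e = G.dst e' → e = e'

/-- In a tree a walk from the root is determined by its endpoint. -/
lemma IsTreelike.eq_of_endpoint_eq {V E : Type} {G : DirectedMultigraph V E} {x₀ : V}
    {α β : List E} (h : G.IsTreelike x₀ α β)
    (hα : G.IsWalk x₀ α) (hβ : G.IsWalk x₀ β) (hab : G.endpoint x₀ α = G.endpoint x₀ β) :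
    α = β := by
  induction α generalizing β with
  | nil =>
    cases β with
    | nil => rfl
    | cons f β => exact absurd hab.symm (h.1 f (by simp))
  | cons e α ih =>
    cases β with
    | nil => exact absurd hab (h.1 e (by simp))
    | cons f β =>
      obtain rfl : e = f := h.2 e (by simp) f (by simp) hab
      rw [ih ⟨fun e he => h.1 e (by simp at he ⊢; tauto), fun e he e' he' =>
        h.2 e (by simp at he ⊢; tauto) e' (by simp at he' ⊢; tauto)⟩ hα.2 hβ.2
        (hα.1.symm.trans hβ.1)]

open Classical in
/-- The probability that two walkers having made the walks `α` and `β` from `x₀` fail to explore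
a tree within `k` further steps. -/
def collideProb (x₀ : V) : ℕ → List E → List E → ℝ
  | 0, α, β => if G.IsTreelike x₀ α β then 0 else 1
  | k + 1, α, β => if G.IsTreelike x₀ α β then
      (G.stepMean (fun e => collideProb x₀ k (e :: α) β) (G.endpoint x₀ α) +
        G.stepMean (fun e => collideProb x₀ k α (e :: β)) (G.endpoint x₀ β)) / 2 else 1

open Classical in
/-- The probability that two walkers having made the walks `α` and `β` from `x₀` have at some
moment of their next `k` steps made exactly the same walk. -/
def followProb (x₀ : V) : ℕ → List E → List E → ℝ
  | 0, α, β => if α = β then 1 else 0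
  | k + 1, α, β => if α = β then 1 else
      (G.stepMean (fun e => followProb x₀ k (e :: α) β) (G.endpoint x₀ α) +
        G.stepMean (fun e => followProb x₀ k α (e :: β)) (G.endpoint x₀ β)) / 2

lemma followProb_mem_Icc (hG : ∀ x, 0 < G.outDegree x) (x₀ : V) (k : ℕ) (α β : List E) :
    G.followProb x₀ k α β ∈ Set.Icc (0 : ℝ) 1 := by
  induction k generalizing α β with
  | zero => unfold followProb; split_ifs <;> simp
  | succ k ih =>
    unfold followProb
    split_ifs with hab
    · simp
    have h1 := G.stepMean_nonneg (x := G.endpoint x₀ α) fun e _ => (ih (e :: α) β).1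
    have h2 := G.stepMean_nonneg (x := G.endpoint x₀ β) fun e _ => (ih α (e :: β)).1
    have h3 := G.stepMean_le (hG (G.endpoint x₀ α)) fun e _ => (ih (e :: α) β).2
    have h4 := G.stepMean_le (hG (G.endpoint x₀ β)) fun e _ => (ih α (e :: β)).2
    exact ⟨by linarith, by linarith⟩

lemma collideProb_mem_Icc (hG : ∀ x, 0 < G.outDegree x) (x₀ : V) (k : ℕ) (α β : List E) :
    G.collideProb x₀ k α β ∈ Set.Icc (0 : ℝ) 1 := by
  induction k generalizing α β with
  | zero => unfold collideProb; split_ifs <;> simp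
  | succ k ih =>
    unfold collideProb
    split_ifs with hab
    · have h1 := G.stepMean_nonneg (x := G.endpoint x₀ α) fun e _ => (ih (e :: α) β).1
      have h2 := G.stepMean_nonneg (x := G.endpoint x₀ β) fun e _ => (ih α (e :: β)).1
      have h3 := G.stepMean_le (hG (G.endpoint x₀ α)) fun e _ => (ih (e :: α) β).2
      have h4 := G.stepMean_le (hG (G.endpoint x₀ β)) fun e _ => (ih α (e :: β)).2
      exact ⟨by linarith, by linarith⟩
    · simp

/-- As long as the walkers explore a tree, they meet exactly when they have made the same walk. -/
lemma abs_meetProb_sub_followProb_le (hG : ∀ x, 0 < G.outDegree x) {x₀ : V} (k : ℕ)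
    {α β : List E} (hα : G.IsWalk x₀ α) (hβ : G.IsWalk x₀ β) :
    |G.meetProb k (G.endpoint x₀ α) (G.endpoint x₀ β) - G.followProb x₀ k α β| ≤
      G.collideProb x₀ k α β := by
  induction k generalizing α β with
  | zero =>
    by_cases ht : G.IsTreelike x₀ α β
    · have : G.endpoint x₀ α = G.endpoint x₀ β ↔ α = β :=
        ⟨fun h => ht.eq_of_endpoint_eq hα hβ h, fun h => h ▸ rfl⟩
      by_cases h : α = β
      · subst h
        simp [meetProb, pairEvolve, followProb, collideProb, ht]
      · simp [meetProb, pairEvolve, followProb, collideProb, ht, h, mt this.1 h]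
    · simp only [meetProb, pairEvolve, followProb, collideProb, if_neg ht]
      split_ifs <;> simp
  | succ k ih =>
    by_cases ht : G.IsTreelike x₀ α β
    swap
    · have h1 := G.meetProb_mem_Icc hG (k + 1) (G.endpoint x₀ α) (G.endpoint x₀ β)
      have h2 := G.followProb_mem_Icc hG x₀ (k + 1) α β
      have h3 : G.collideProb x₀ (k + 1) α β = 1 := by simp [collideProb, ht]
      rw [h3, abs_le]
      exact ⟨by linarith [h1.1, h2.2], by linarith [h1.2, h2.1]⟩
    by_cases hab : α = β
    · subst hab
      rw [meetProb, pairEvolve_self, followProb]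
      simpa using (G.collideProb_mem_Icc hG x₀ (k + 1) α α).1
    have hne : G.endpoint x₀ α ≠ G.endpoint x₀ β := fun h => hab (ht.eq_of_endpoint_eq hα hβ h)
    have h1 := G.abs_stepMean_sub_le (x := G.endpoint x₀ α)
      (f := fun e => G.meetProb k (G.dst e) (G.endpoint x₀ β)) fun e he =>
      ih (α := e :: α) (β := β) ⟨he, hα⟩ hβ
    have h2 := G.abs_stepMean_sub_le (x := G.endpoint x₀ β)
      (f := fun e => G.meetProb k (G.endpoint x₀ α) (G.dst e)) fun e he =>
      ih (α := α) (β := e :: β) hα ⟨he, hβ⟩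
    rw [meetProb, pairEvolve_succ_of_ne G _ _ hne]
    simp only [followProb, collideProb, hab, ht, if_true, if_false]
    simp only [meetProb] at h1 h2
    rw [abs_le] at *
    exact ⟨by linarith, by linarith⟩

/-! ### Counting the ways of catching up -/

/-- The mean over the `k`-step random walk from `v` of the product of the reciprocals of the
out-degrees of the vertices it leaves: the probability that an independent walk from `v` takes the
same edges. -/
def branchProb : ℕ → V → ℝ
  | 0, _ => 1
  | k + 1, v => 1 / (G.outDegree v : ℝ) * G.stepMean (fun e => branchProb k (G.dst e)) v

lemma branchProb_mem_Icc (hG : ∀ x, 2 ≤ G.outDegree x) (k : ℕ) (v : V) :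
    G.branchProb k v ∈ Set.Icc (0 : ℝ) ((1 / 2) ^ k) := by
  induction k generalizing v with
  | zero => simp [branchProb]
  | succ k ih =>
    have h1 := G.stepMean_nonneg (x := v) fun e _ => (ih (G.dst e)).1
    have h2 := G.stepMean_le ((Nat.zero_lt_two).trans_le (hG v)) fun e _ => (ih (G.dst e)).2
    have h3 : 1 / (G.outDegree v : ℝ) ≤ 1 / 2 :=
      one_div_le_one_div_of_le two_pos (by exact_mod_cast hG v)
    unfold branchProb
    refine ⟨by positivity, ?_⟩
    rw [pow_succ']
    gcongr

lemma followProb_eq_zero (x₀ : V) (k : ℕ) {α β : List E} (h1 : ¬ α <:+ β) (h2 : ¬ β <:+ α) :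
    G.followProb x₀ k α β = 0 := by
  have hab : α ≠ β := fun h => h1 (h ▸ List.suffix_rfl)
  induction k generalizing α β with
  | zero => simp [followProb, hab]
  | succ k ih =>
    have hα : ∀ e : E, G.followProb x₀ k (e :: α) β = 0 := fun e => by
      have h3 : ¬ (e :: α) <:+ β := fun h => h1 ((List.suffix_cons e α).trans h)
      have h4 : ¬ β <:+ (e :: α) := fun h => by
        rcases List.suffix_cons_iff.1 h with rfl | h
        · exact h3 List.suffix_rfl
        · exact h2 h
      exact ih h3 h4 fun h => h3 (h ▸ List.suffix_rfl)
    have hβ : ∀ e : E, G.followProb x₀ k α (e :: β) = 0 := fun e => by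
      have h3 : ¬ (e :: β) <:+ α := fun h => h2 ((List.suffix_cons e β).trans h)
      have h4 : ¬ α <:+ (e :: β) := fun h => by
        rcases List.suffix_cons_iff.1 h with rfl | h
        · exact h3 List.suffix_rfl
        · exact h1 h
      exact ih h4 h3 fun h => h4 (h ▸ List.suffix_rfl)
    simp [followProb, hab, hα, hβ, stepMean]

/-- The probability that a random walk takes the edges of the list `p`. -/
def walkWeight (p : List E) : ℝ := (p.map fun e => 1 / (G.outDegree (G.src e) : ℝ)).prod

lemma IsWalk.of_append {V E : Type} {G : DirectedMultigraph V E} {x₀ : V} {p α : List E}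
    (h : G.IsWalk x₀ (p ++ α)) : G.IsWalk x₀ α := by
  induction p with
  | nil => exact h
  | cons e p ih => exact ih h.2

/-- If the second walker is ahead by the walk `p`, the first one catches up after
`length p + 2 * j` steps by retracing `p` and the `j` steps that the second one makes meanwhile. -/
lemma followProb_append (x₀ : V) (k : ℕ) (α p : List E) (hp : G.IsWalk x₀ (p ++ α)) :
    G.followProb x₀ k α (p ++ α) = G.walkWeight p * ∑ j ∈ Finset.range (k + 1),
      if p.length + 2 * j ≤ k then (ballotNumber p.length j : ℝ) * (1 / 2) ^ (p.length + 2 * j) *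
        G.branchProb j (G.endpoint x₀ (p ++ α)) else 0 := by
  induction k generalizing α p with
  | zero =>
    cases p with
    | nil => simp [followProb, walkWeight, ballotNumber_zero_left, branchProb]
    | cons e p =>
      have : α ≠ e :: (p ++ α) := fun h => by
        have := congrArg List.length h
        simp only [List.length_cons, List.length_append] at this
        omega
      simp [followProb, this]
  | succ k ih =>
    rcases List.eq_nil_or_concat p with rfl | ⟨q, c, rfl⟩
    · have : ∀ j : ℕ, (if ([] : List E).length + 2 * j ≤ k + 1 then
          (ballotNumber ([] : List E).length j : ℝ) * (1 / 2) ^ (([] : List E).length + 2 * j) *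
          G.branchProb j (G.endpoint x₀ ([] ++ α)) else 0) = if j = 0 then 1 else 0 := by
        intro j
        by_cases hj : j = 0
        · simp [hj, ballotNumber_zero_left, branchProb]
        · simp [ballotNumber_zero_left, hj]
      simp only [this]
      simp [followProb, walkWeight]
    rw [List.concat_eq_append] at hp ⊢
    set β := q ++ [c] ++ α with hβ
    set b := G.endpoint x₀ β with hb
    have hβ' : β = q ++ c :: α := by simp [hβ]
    have hcα : G.IsWalk x₀ (c :: α) := IsWalk.of_append (p := q) (hβ' ▸ hp)
    have hc : G.src c = G.endpoint x₀ α := hcα.1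
    have hlen : β.length = q.length + 1 + α.length := by
      rw [hβ', List.length_append, List.length_cons]
      omega
    have hne : α ≠ β := fun h => by
      have := congrArg List.length h
      omega
    -- the first walker loses track of the second one unless its next edge is `c`
    have hfirst : G.stepMean (fun e => G.followProb x₀ k (e :: α) β) (G.endpoint x₀ α) =
        1 / (G.outDegree (G.src c) : ℝ) * G.followProb x₀ k (c :: α) (q ++ c :: α) := by
      rw [stepMean, hc, Finset.sum_eq_single c, hβ']
      · intro e _ hec
        have h1 : ¬ (e :: α) <:+ β := fun h => by
          have h2 := List.suffix_of_suffix_length_le h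
            (hβ' ▸ List.suffix_append q (c :: α) : (c :: α) <:+ β) (by simp)
          exact hec (List.cons.inj (h2.eq_of_length (by simp))).1
        refine G.followProb_eq_zero x₀ k h1 fun h => ?_
        rw [h.eq_of_length_le (by rw [hlen, List.length_cons]; omega)] at h1
        exact h1 List.suffix_rfl
      · intro h
        simp [hc] at h
    have hsecond : G.stepMean (fun e => G.followProb x₀ k α (e :: β)) b =
        G.walkWeight (q ++ [c]) * ∑ j ∈ Finset.range (k + 1),
          if q.length + 2 + 2 * j ≤ k then (ballotNumber (q.length + 2) j : ℝ) *
            (1 / 2) ^ (q.length + 2 + 2 * j) * G.branchProb (j + 1) b else 0 := by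
      have : ∀ e, G.src e = b → G.followProb x₀ k α (e :: β) =
          G.walkWeight (q ++ [c]) * ((1 / (G.outDegree b : ℝ)) *
            ∑ j ∈ Finset.range (k + 1), (if q.length + 2 + 2 * j ≤ k then
              (ballotNumber (q.length + 2) j : ℝ) * (1 / 2) ^ (q.length + 2 + 2 * j) else 0) *
                G.branchProb j (G.dst e)) := by
        intro e he
        have h := ih α (e :: (q ++ [c])) ⟨he, hp⟩
        simp only [List.cons_append, List.length_cons, List.length_append, List.length_nil,
          zero_add] at h
        rw [hβ, List.append_assoc, List.singleton_append] at *
        rw [h]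
        simp only [walkWeight, List.map_cons, List.prod_cons, endpoint, he, ite_mul, zero_mul]
        ring
      rw [G.stepMean_congr this, stepMean_const_mul, stepMean_const_mul, stepMean_sum]
      simp only [stepMean_const_mul, branchProb, Finset.mul_sum]
      refine Finset.sum_congr rfl fun j _ => ?_
      split_ifs <;> ring
    have hw : G.walkWeight (q ++ [c]) = 1 / (G.outDegree (G.src c) : ℝ) * G.walkWeight q := by
      simp [walkWeight, mul_comm]
    have hend : G.endpoint x₀ (q ++ c :: α) = b := by rw [hb, hβ']
    rw [followProb, if_neg hne, hfirst, ih (c :: α) q (hβ' ▸ hp), hsecond, hend]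
    simp only [List.length_append, List.length_singleton]
    rw [Finset.sum_range_succ' _ (k + 1)]
    -- the ballot numbers decompose according to who makes the first step
    have hrec : ∀ j, (if q.length + 1 + 2 * (j + 1) ≤ k + 1 then
        (ballotNumber (q.length + 1) (j + 1) : ℝ) * (1 / 2) ^ (q.length + 1 + 2 * (j + 1)) *
          G.branchProb (j + 1) b else 0) =
        1 / 2 * (if q.length + 2 * (j + 1) ≤ k then (ballotNumber q.length (j + 1) : ℝ) *
          (1 / 2) ^ (q.length + 2 * (j + 1)) * G.branchProb (j + 1) b else 0) +
        1 / 2 * (if q.length + 2 + 2 * j ≤ k then (ballotNumber (q.length + 2) j : ℝ) *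
          (1 / 2) ^ (q.length + 2 + 2 * j) * G.branchProb (j + 1) b else 0) := by
      intro j
      rw [ballotNumber_succ]
      by_cases h : q.length + 2 + 2 * j ≤ k
      · rw [if_pos (by omega), if_pos (by omega), if_pos h]
        push_cast
        ring
      · rw [if_neg (by omega), if_neg (by omega), if_neg h]
        simp
    have hlast : ∑ j ∈ Finset.range (k + 1), (if q.length + 2 * j ≤ k then
        (ballotNumber q.length j : ℝ) * (1 / 2) ^ (q.length + 2 * j) * G.branchProb j b else 0) =
        ∑ j ∈ Finset.range (k + 1), (if q.length + 2 * (j + 1) ≤ k then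
          (ballotNumber q.length (j + 1) : ℝ) * (1 / 2) ^ (q.length + 2 * (j + 1)) *
            G.branchProb (j + 1) b else 0) + if q.length ≤ k then (1 / 2) ^ q.length else 0 := by
      have h := Finset.sum_range_succ' (fun j => if q.length + 2 * j ≤ k then
        (ballotNumber q.length j : ℝ) * (1 / 2) ^ (q.length + 2 * j) * G.branchProb j b else 0)
          (k + 1)
      rw [Finset.sum_range_succ, if_neg (by omega), add_zero] at h
      simpa [ballotNumber_zero_right, branchProb] using h
    rw [hlast, Finset.sum_congr rfl fun j _ => hrec j, Finset.sum_add_distrib, ← Finset.mul_sum,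
      ← Finset.mul_sum, hw]
    simp only [mul_zero, add_zero, ballotNumber_zero_right, branchProb, add_le_add_iff_right]
    split_ifs <;> push_cast <;> ring

/-- The sum over the edges `e` of the probability that a walker from the tail of `e` takes `e`
and then the same `j` edges as a walker from the head of `e`, divided by the number of edges. -/
def edgeBranchMean (j : ℕ) : ℝ :=
  1 / (Fintype.card E : ℝ) *
    ∑ e : E, 1 / (G.outDegree (G.src e) : ℝ) * G.branchProb j (G.dst e)

/-- The mean over the edges `e` of the probability that the walkers started from the tail and
the head of `e` fail to explore a tree within `k` steps. -/
def edgeCollideProb (k : ℕ) : ℝ :=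
  1 / (Fintype.card E : ℝ) * ∑ e : E, G.collideProb (G.src e) k [] [e]

lemma abs_edgeMeetProb_sub_le (hG : ∀ x, 0 < G.outDegree x) (k : ℕ) :
    |G.edgeMeetProb k - ∑ j ∈ Finset.range (k + 1), if 1 + 2 * j ≤ k then
      (catalan j : ℝ) * (1 / 2) ^ (1 + 2 * j) * G.edgeBranchMean j else 0| ≤
      G.edgeCollideProb k := by
  have hfollow : ∀ e, G.followProb (G.src e) k [] [e] =
      ∑ j ∈ Finset.range (k + 1), (if 1 + 2 * j ≤ k then
        (catalan j : ℝ) * (1 / 2) ^ (1 + 2 * j) else 0) *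
          (1 / (G.outDegree (G.src e) : ℝ) * G.branchProb j (G.dst e)) := by
    intro e
    have h := G.followProb_append (G.src e) k [] [e] ⟨rfl, trivial⟩
    simp only [List.append_nil, List.length_singleton, ballotNumber_one_left, endpoint] at h
    rw [h, Finset.mul_sum]
    refine Finset.sum_congr rfl fun j _ => ?_
    simp only [walkWeight, List.map_cons, List.map_nil, List.prod_singleton]
    split_ifs <;> ring
  have hsum : (∑ j ∈ Finset.range (k + 1), if 1 + 2 * j ≤ k then
      (catalan j : ℝ) * (1 / 2) ^ (1 + 2 * j) * G.edgeBranchMean j else 0) =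
      1 / (Fintype.card E : ℝ) * ∑ e : E, G.followProb (G.src e) k [] [e] := by
    simp only [hfollow]
    rw [Finset.sum_comm]
    simp only [← Finset.mul_sum, edgeBranchMean]
    rw [Finset.mul_sum]
    refine Finset.sum_congr rfl fun j _ => ?_
    split_ifs <;> ring
  rw [hsum, edgeMeetProb, edgeCollideProb, ← mul_sub, ← Finset.sum_sub_distrib, abs_mul,
    abs_of_nonneg (by positivity : 0 ≤ 1 / (Fintype.card E : ℝ))]
  gcongr
  refine (Finset.abs_sum_le_sum_abs _ _).trans (Finset.sum_le_sum fun e _ => ?_)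
  exact G.abs_meetProb_sub_followProb_le hG k (x₀ := G.src e) (α := []) (β := [e]) trivial
    ⟨rfl, trivial⟩

end DirectedMultigraph

/-! ### Uniform matchings conditioned on some of their values -/

section Cylinder

variable {E I : Type} [Fintype E] [DecidableEq E] [Fintype I] [DecidableEq I]

/-- The bijections that agree with `ω₀` on `R`. -/
def matchingCylinder (R : Finset E) (ω₀ : E ≃ I) : Finset (E ≃ I) :=
  Finset.univ.filter fun ω => ∀ e ∈ R, ω e = ω₀ e

lemma mem_matchingCylinder {R : Finset E} {ω₀ ω : E ≃ I} :
    ω ∈ matchingCylinder R ω₀ ↔ ∀ e ∈ R, ω e = ω₀ e := by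
  simp [matchingCylinder]

lemma matchingCylinder_empty (ω₀ : E ≃ I) : matchingCylinder ∅ ω₀ = Finset.univ := by
  ext; simp [mem_matchingCylinder]

lemma filter_matchingCylinder {R : Finset E} {ω₀ ω₁ : E ≃ I} (h : ω₁ ∈ matchingCylinder R ω₀)
    (e : E) : (matchingCylinder R ω₀).filter (fun ω => ω e = ω₁ e) =
      matchingCylinder (insert e R) ω₁ := by
  ext ω
  rw [mem_matchingCylinder] at h
  simp only [Finset.mem_filter, mem_matchingCylinder, Finset.forall_mem_insert, and_comm]
  exact and_congr_right fun _ => forall₂_congr fun r hr => by rw [h r hr]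

/-- Conditionally on its values on `R`, a uniform bijection maps `e ∉ R` to a given point with
probability at most `1 / (|E| - |R|)`. -/
lemma card_filter_matchingCylinder_mul_le {R : Finset E} (ω₀ : E ≃ I) {e : E} (he : e ∉ R) (i : I) :
    ((matchingCylinder R ω₀).filter fun ω => ω e = i).card * (Fintype.card E - R.card) ≤
      (matchingCylinder R ω₀).card := by
  -- precomposition with a transposition shows that all `e' ∉ R` are equally likely preimages of `i`
  have hswap : ∀ e' ∈ Rᶜ, ((matchingCylinder R ω₀).filter fun ω => ω e = i).card ≤
      ((matchingCylinder R ω₀).filter fun ω => ω.symm i = e').card := by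
    intro e' he'
    rw [Finset.mem_compl] at he'
    refine Finset.card_le_card_of_injOn (fun ω => (Equiv.swap e e').trans ω) ?_ ?_
    · intro ω hω
      simp only [Finset.coe_filter, Set.mem_ofPred_eq, mem_matchingCylinder] at hω ⊢
      refine ⟨fun r hr => ?_, ?_⟩
      · rw [Equiv.trans_apply, Equiv.swap_apply_of_ne_of_ne (ne_of_mem_of_not_mem hr he)
          (ne_of_mem_of_not_mem hr he')]
        exact hω.1 r hr
      · rw [Equiv.symm_apply_eq, Equiv.trans_apply, Equiv.swap_apply_right, hω.2]
    · intro ω _ ω' _ h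
      ext x
      have := congrArg (fun f : E ≃ I => f (Equiv.swap e e' x)) h
      simpa using this
  calc _ = ∑ _e' ∈ Rᶜ, ((matchingCylinder R ω₀).filter fun ω => ω e = i).card := by
        rw [Finset.sum_const, Finset.card_compl, smul_eq_mul, mul_comm]
    _ ≤ ∑ e' ∈ Rᶜ, ((matchingCylinder R ω₀).filter fun ω => ω.symm i = e').card :=
        Finset.sum_le_sum hswap
    _ = ((matchingCylinder R ω₀).filter fun ω => ω.symm i ∈ Rᶜ).card := by
        rw [Finset.card_eq_sum_card_fiberwise
          (s := (matchingCylinder R ω₀).filter fun ω => ω.symm i ∈ Rᶜ)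
          (f := fun ω : E ≃ I => ω.symm i) (t := Rᶜ)
          fun ω hω => (Finset.mem_filter.1 hω).2]
        refine Finset.sum_congr rfl fun e' he' => ?_
        rw [Finset.filter_filter]
        congr 1
        refine Finset.filter_congr fun ω _ => ⟨fun h => ⟨h ▸ he', h⟩, fun h => h.2⟩
    _ ≤ _ := Finset.card_filter_le _ _

lemma card_filter_matchingCylinder_le {R : Finset E} (ω₀ : E ≃ I) {e : E} (he : e ∉ R) (i : I) :
    (((matchingCylinder R ω₀).filter fun ω => ω e = i).card : ℝ) ≤
      (matchingCylinder R ω₀).card / (Fintype.card E - R.card : ℝ) := by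
  have hlt : R.card < Fintype.card E := by
    rw [← Finset.card_univ]
    exact Finset.card_lt_card (Finset.ssubset_univ_iff.2 fun h => he (h ▸ Finset.mem_univ e))
  have h := card_filter_matchingCylinder_mul_le ω₀ he i
  have hlt' : (R.card : ℝ) < Fintype.card E := by exact_mod_cast hlt
  rw [le_div_iff₀ (by linarith), ← Nat.cast_sub hlt.le]
  exact_mod_cast h

/-- Revealing one more value: if the conditional mean of `g` given the value at `e` is at most `c`
in absolute value unless that value lies in the set `B`, then the mean of `g` is at most `c` plus
the probability of `B`. -/
lemma abs_sum_matchingCylinder_le {R : Finset E} (ω₀ : E ≃ I) {e : E} (he : e ∉ R)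
    (B : Finset I) {g : (E ≃ I) → ℝ} {c : ℝ} (hc : 0 ≤ c) (hg : ∀ ω, |g ω| ≤ 1)
    (h : ∀ ω₁ ∈ matchingCylinder R ω₀, ω₁ e ∉ B →
      |∑ ω ∈ matchingCylinder (insert e R) ω₁, g ω| ≤
        c * (matchingCylinder (insert e R) ω₁).card) :
    |∑ ω ∈ matchingCylinder R ω₀, g ω| ≤
      (c + B.card / (Fintype.card E - R.card : ℝ)) * (matchingCylinder R ω₀).card := by
  set K := matchingCylinder R ω₀
  have hfib : ∀ i, |∑ ω ∈ K with ω e = i, g ω| ≤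
      c * (K.filter fun ω => ω e = i).card +
        if i ∈ B then ((K.filter fun ω => ω e = i).card : ℝ) else 0 := by
    intro i
    split_ifs with hi
    · have h1 : |∑ ω ∈ K with ω e = i, g ω| ≤ ∑ ω ∈ K with ω e = i, (1 : ℝ) :=
        (Finset.abs_sum_le_sum_abs _ _).trans (Finset.sum_le_sum fun ω _ => hg ω)
      have h2 : 0 ≤ c * (K.filter fun ω => ω e = i).card := by positivity
      simp only [Finset.sum_const, nsmul_eq_mul, mul_one] at h1
      linarith
    · rcases (K.filter fun ω => ω e = i).eq_empty_or_nonempty with h0 | ⟨ω₁, hω₁⟩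
      · simp [h0]
      · obtain ⟨h1, rfl⟩ := Finset.mem_filter.1 hω₁
        rw [add_zero, filter_matchingCylinder h1]
        exact h ω₁ h1 hi
  calc |∑ ω ∈ K, g ω| = |∑ i, ∑ ω ∈ K with ω e = i, g ω| := by rw [Finset.sum_fiberwise]
    _ ≤ ∑ i, |∑ ω ∈ K with ω e = i, g ω| := Finset.abs_sum_le_sum_abs _ _
    _ ≤ ∑ i, (c * (K.filter fun ω => ω e = i).card +
        if i ∈ B then ((K.filter fun ω => ω e = i).card : ℝ) else 0) :=
        Finset.sum_le_sum fun i _ => hfib i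
    _ = c * K.card + ∑ i ∈ B, ((K.filter fun ω => ω e = i).card : ℝ) := by
        rw [Finset.sum_add_distrib, ← Finset.mul_sum, ← Finset.sum_filter,
          Finset.filter_mem_eq_inter, Finset.univ_inter, ← Nat.cast_sum,
          ← Finset.card_eq_sum_card_fiberwise]
        exact fun _ _ => Finset.mem_univ _
    _ ≤ c * K.card + ∑ i ∈ B, (K.card / (Fintype.card E - R.card : ℝ)) := by
        gcongr with i
        exact card_filter_matchingCylinder_le ω₀ he i
    _ = _ := by
        rw [Finset.sum_const, nsmul_eq_mul]
        ring

/-- The image of `e ∉ R` under a uniform bijection with prescribed values on `R` is nearly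
uniform. -/
lemma abs_sum_matchingCylinder_apply_sub_le {R : Finset E} (ω₀ : E ≃ I) {e : E} (he : e ∉ R)
    {f : I → ℝ} (hf : ∀ i, f i ∈ Set.Icc (0 : ℝ) 1) :
    |∑ ω ∈ matchingCylinder R ω₀, (f (ω e) - 1 / (Fintype.card E : ℝ) * ∑ i, f i)| ≤
      R.card / (Fintype.card E - R.card : ℝ) * (matchingCylinder R ω₀).card := by
  set K := matchingCylinder R ω₀
  have hlt : R.card < Fintype.card E := by
    rw [← Finset.card_univ]
    exact Finset.card_lt_card (Finset.ssubset_univ_iff.2 fun h => he (h ▸ Finset.mem_univ e))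
  have hlt' : (0 : ℝ) < Fintype.card E - R.card := by
    rw [sub_pos]
    exact_mod_cast hlt
  have hm : (0 : ℝ) < Fintype.card E := by exact_mod_cast (Nat.zero_le _).trans_lt hlt
  have hEI : Fintype.card I = Fintype.card E := (Fintype.card_congr ω₀).symm
  -- the lower bound is the upper one for `1 - f`
  have upper : ∀ f : I → ℝ, (∀ i, f i ∈ Set.Icc (0 : ℝ) 1) →
      ∑ ω ∈ K, (f (ω e) - 1 / (Fintype.card E : ℝ) * ∑ i, f i) ≤
        R.card / (Fintype.card E - R.card : ℝ) * K.card := by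
    intro f hf
    have h1 : ∑ ω ∈ K, f (ω e) ≤ ∑ i, K.card / (Fintype.card E - R.card : ℝ) * f i := by
      rw [← Finset.sum_fiberwise K (fun ω => ω e)]
      refine Finset.sum_le_sum fun i _ => ?_
      rw [Finset.sum_congr rfl (g := fun _ => f i) fun ω hω => by rw [(Finset.mem_filter.1 hω).2],
        Finset.sum_const, nsmul_eq_mul]
      exact mul_le_mul_of_nonneg_right (card_filter_matchingCylinder_le ω₀ he i) (hf i).1
    have h2 : ∑ i, f i ≤ Fintype.card E := by
      refine (Finset.sum_le_card_nsmul _ _ 1 fun i _ => (hf i).2).trans ?_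
      simp [hEI]
    rw [Finset.sum_sub_distrib, Finset.sum_const, nsmul_eq_mul]
    rw [← Finset.mul_sum] at h1
    have h3 : (K.card : ℝ) / (Fintype.card E - R.card : ℝ) * ∑ i, f i -
        K.card * (1 / (Fintype.card E : ℝ) * ∑ i, f i) =
        R.card / (Fintype.card E - R.card : ℝ) * K.card * ((∑ i, f i) / Fintype.card E) := by
      field_simp
      ring
    have h4 : (∑ i, f i) / Fintype.card E ≤ 1 := (div_le_one hm).2 h2
    have h5 := mul_le_mul_of_nonneg_left h4
      (by positivity : 0 ≤ R.card / (Fintype.card E - R.card : ℝ) * K.card)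
    linarith
  rw [abs_le]
  refine ⟨?_, upper f hf⟩
  have h := upper (fun i => 1 - f i) fun i =>
    ⟨by linarith [(hf i).2], by linarith [(hf i).1]⟩
  have h6 : ∀ ω : E ≃ I, 1 - f (ω e) - 1 / (Fintype.card E : ℝ) * ∑ i, (1 - f i) =
      -(f (ω e) - 1 / (Fintype.card E : ℝ) * ∑ i, f i) := by
    intro ω
    rw [Finset.sum_sub_distrib, Finset.sum_const, Finset.card_univ, hEI]
    simp only [nsmul_eq_mul, mul_one]
    field_simp
    ring
  simp only [h6, Finset.sum_neg_distrib] at h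
  linarith

end Cylinder

namespace BiDegreeSequence

variable {n : ℕ} (d : BiDegreeSequence n)

/-! ### The graph of a uniform matching -/

lemma card_outStub : Fintype.card d.OutStub = d.numEdges := by simp [numEdges]

lemma card_inStub : Fintype.card d.InStub = d.numEdges := by simp [numEdges, d.balanced]

lemma graph_outDegree (ω : d.Configuration) (x : Fin n) :
    (d.graph ω).outDegree x = d.outDeg x := by
  have h : (Finset.univ.filter fun e : d.OutStub => e.1 = x) =
      ({x} : Finset (Fin n)).sigma fun _ => Finset.univ := by
    ext e
    simp
  change (Finset.univ.filter fun e : d.OutStub => e.1 = x).card = _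
  rw [h, Finset.card_sigma, Finset.sum_singleton, Finset.card_univ, Fintype.card_fin]

lemma rho_eq : d.rho = 1 / (Fintype.card d.OutStub : ℝ) *
    ∑ i : d.InStub, 1 / (d.outDeg i.1 : ℝ) := by
  rw [rho, card_outStub, Fintype.sum_sigma]
  congr 1
  refine Finset.sum_congr rfl fun x _ => ?_
  simp [div_eq_mul_inv]

variable {d} in
lemma inv_outDeg_mem_Icc (h2 : ∀ x, 2 ≤ d.outDeg x) (x : Fin n) :
    1 / (d.outDeg x : ℝ) ∈ Set.Icc (0 : ℝ) (1 / 2) :=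
  ⟨by positivity, one_div_le_one_div_of_le two_pos (by exact_mod_cast h2 x)⟩

variable {d} in
lemma rho_mem_Icc (h2 : ∀ x, 2 ≤ d.outDeg x) : d.rho ∈ Set.Icc (0 : ℝ) (1 / 2) := by
  have h0 := fun x => inv_outDeg_mem_Icc h2 x
  rw [rho_eq]
  refine ⟨mul_nonneg (by positivity) (Finset.sum_nonneg fun i _ => (h0 i.1).1), ?_⟩
  have h1 := Finset.sum_le_card_nsmul (Finset.univ : Finset d.InStub)
    (fun i => 1 / (d.outDeg i.1 : ℝ)) (1 / 2) fun i _ => (h0 i.1).2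
  rw [Finset.card_univ, card_inStub, nsmul_eq_mul] at h1
  rw [card_outStub, one_div_mul_eq_div]
  exact div_le_of_le_mul₀ (by positivity) (by norm_num) (by linarith)

/-- The in-stubs at the vertices of a set. -/
def inStubsOn (S : Finset (Fin n)) : Finset d.InStub := Finset.univ.filter fun i => i.1 ∈ S

variable {d} in
lemma card_inStubsOn_le {D : ℕ} (hD : ∀ x, d.inDeg x ≤ D) (S : Finset (Fin n)) :
    (d.inStubsOn S).card ≤ D * S.card := by
  have h : d.inStubsOn S = S.sigma fun _ => Finset.univ := by
    ext i
    simp [inStubsOn]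
  rw [h, Finset.card_sigma, mul_comm, ← smul_eq_mul]
  refine Finset.sum_le_card_nsmul _ _ _ fun x _ => ?_
  simpa using hD x

/-- The average over all configurations. -/
def average (f : d.Configuration → ℝ) : ℝ :=
  1 / (Fintype.card d.Configuration : ℝ) * ∑ ω, f ω

/-! ### Concentration of the probability of retracing a walk -/

variable {d} in
/-- Two walks from distinct unrevealed edges visit vertices with asymptotically independent,
in-degree-biased out-degrees, since they are unlikely to run into each other or into the edges
already revealed. -/
lemma abs_sum_branchProb_mul_sub_le (h2 : ∀ x, 2 ≤ d.outDeg x) {D M : ℕ}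
    (hD : ∀ x, d.inDeg x ≤ D) (hM : 2 * M ≤ d.numEdges) (N k l : ℕ) (hN : k + l = N)
    (R : Finset d.OutStub) (ω₀ : d.Configuration) {e e' : d.OutStub} (he : e ∉ R) (he' : e' ∉ R)
    (hee' : e ≠ e') (hR : R.card + N ≤ M) :
    |∑ ω ∈ matchingCylinder R ω₀, ((d.graph ω).branchProb k ((d.graph ω).dst e) *
        (d.graph ω).branchProb l ((d.graph ω).dst e') - d.rho ^ N)| ≤
      N * (2 * (D * (M + 2) + M) / d.numEdges : ℝ) * (matchingCylinder R ω₀).card := by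
  have hG : ∀ ω x, 2 ≤ (d.graph ω).outDegree x := fun ω x => by
    rw [graph_outDegree]
    exact h2 x
  have hbp : ∀ ω k x, (d.graph ω).branchProb k x ∈ Set.Icc (0 : ℝ) 1 := fun ω k x =>
    Set.Icc_subset_Icc_right (pow_le_one₀ (by norm_num) (by norm_num))
      ((d.graph ω).branchProb_mem_Icc (hG ω) k x)
  have hρ := rho_mem_Icc h2
  induction N generalizing k l R ω₀ e e' with
  | zero =>
    obtain ⟨rfl, rfl⟩ : k = 0 ∧ l = 0 := by omega
    simp [DirectedMultigraph.branchProb]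
  | succ N ih =>
    wlog hk : ∃ k', k = k' + 1 generalizing k l e e'
    · have hl : ∃ l', l = l' + 1 := by
        have : k = 0 := by
          by_contra h
          exact hk ⟨k - 1, by omega⟩
        exact ⟨l - 1, by omega⟩
      simpa only [mul_comm] using this l k (by omega) he' he hee'.symm hl
    obtain ⟨k, rfl⟩ := hk
    have hkl : k + l = N := by omega
    set κ : ℝ := 2 * (D * (M + 2) + M) / d.numEdges with hκ
    have hκ0 : 0 ≤ κ := by positivity
    set S : Finset (Fin n) := (insert e (insert e' R)).image Sigma.fst with hS
    have hφ : ∀ i : d.InStub, 1 / (d.outDeg i.1 : ℝ) ∈ Set.Icc (0 : ℝ) 1 := fun i =>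
      Set.Icc_subset_Icc_right (by norm_num) (inv_outDeg_mem_Icc h2 i.1)
    have hρN : d.rho ^ N ∈ Set.Icc (0 : ℝ) 1 :=
      ⟨pow_nonneg hρ.1 _, pow_le_one₀ hρ.1 (hρ.2.trans (by norm_num))⟩
    -- reveal the value at `e`; the estimate for `N` applies if its vertex is a new one
    have hreveal := abs_sum_matchingCylinder_le ω₀ he (d.inStubsOn S) (c := N * κ)
      (g := fun ω => (d.graph ω).branchProb (k + 1) ((d.graph ω).dst e) *
        (d.graph ω).branchProb l ((d.graph ω).dst e') -
          d.rho ^ N * (1 / (d.outDeg (ω e).1 : ℝ))) (by positivity)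
      (fun ω => by
        have h1 := hbp ω (k + 1) ((d.graph ω).dst e)
        have h2 := hbp ω l ((d.graph ω).dst e')
        have h3 := hφ (ω e)
        have h4 := mul_le_one₀ h1.2 h2.1 h2.2
        have h5 := mul_nonneg h1.1 h2.1
        have h6 := mul_le_one₀ hρN.2 h3.1 h3.2
        have h7 := mul_nonneg hρN.1 h3.1
        rw [abs_le]
        exact ⟨by linarith, by linarith⟩)
      (fun ω₁ _ hω₁ => by
        set v := (ω₁ e).1 with hv
        have hvS : v ∉ S := by simpa [inStubsOn] using hω₁
        have hnew : ∀ f : d.OutStub, f.1 = v → f ∉ insert e R ∧ f ≠ e' := by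
          intro f hf
          have : f ∉ insert e (insert e' R) := fun h =>
            hvS (hf ▸ Finset.mem_image_of_mem _ h)
          simp only [Finset.mem_insert, not_or] at this ⊢
          tauto
        have hsum : ∑ ω ∈ matchingCylinder (insert e R) ω₁,
            ((d.graph ω).branchProb (k + 1) ((d.graph ω).dst e) *
              (d.graph ω).branchProb l ((d.graph ω).dst e') -
              d.rho ^ N * (1 / (d.outDeg (ω e).1 : ℝ))) =
            1 / (d.outDeg v : ℝ) * (d.graph ω₁).stepMean (fun f =>
              ∑ ω ∈ matchingCylinder (insert e R) ω₁,
                ((d.graph ω).branchProb k ((d.graph ω).dst f) *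
                  (d.graph ω).branchProb l ((d.graph ω).dst e') - d.rho ^ N)) v := by
          rw [DirectedMultigraph.stepMean_sum, Finset.mul_sum]
          refine Finset.sum_congr rfl fun ω hω => ?_
          have hωe : ω e = ω₁ e := mem_matchingCylinder.1 hω e (Finset.mem_insert_self _ _)
          have hdst : (d.graph ω).dst e = v := congrArg Sigma.fst hωe
          rw [DirectedMultigraph.stepMean_sub, DirectedMultigraph.stepMean_const _
            (two_pos.trans_le (hG _ _)), hdst, hωe, ← hv, DirectedMultigraph.branchProb,
            graph_outDegree]
          have hcomm := (d.graph ω).stepMean_const_mul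
            ((d.graph ω).branchProb l ((d.graph ω).dst e'))
            (fun f => (d.graph ω).branchProb k ((d.graph ω).dst f)) v
          simp only [mul_comm ((d.graph ω).branchProb l _)] at hcomm
          change _ = 1 / (d.outDeg v : ℝ) * ((d.graph ω).stepMean _ v - _)
          rw [hcomm]
          ring
        rw [hsum, abs_mul, abs_of_nonneg (hφ (ω₁ e)).1]
        have hstep := (d.graph ω₁).abs_stepMean_sub_le (x := v) (g := fun _ => 0)
          (h := fun _ => N * κ * (matchingCylinder (insert e R) ω₁).card)
          fun f hf => by
            rw [sub_zero]
            exact ih k l hkl (insert e R) ω₁ (hnew f hf).1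
              (by simp [he', hee'.symm]) (hnew f hf).2
              (by rw [Finset.card_insert_of_notMem he]; omega)
        rw [DirectedMultigraph.stepMean_const _ (two_pos.trans_le (hG _ _)),
          DirectedMultigraph.stepMean_const _ (two_pos.trans_le (hG _ _)), sub_zero] at hstep
        exact (mul_le_of_le_one_left (abs_nonneg _) (hφ (ω₁ e)).2).trans hstep)
    have hunif := abs_sum_matchingCylinder_apply_sub_le ω₀ he hφ
    rw [← rho_eq, card_outStub] at hunif
    rw [card_outStub] at hreveal
    set K := matchingCylinder R ω₀
    have hsplit : ∑ ω ∈ K, ((d.graph ω).branchProb (k + 1) ((d.graph ω).dst e) *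
        (d.graph ω).branchProb l ((d.graph ω).dst e') - d.rho ^ (N + 1)) =
        ∑ ω ∈ K, ((d.graph ω).branchProb (k + 1) ((d.graph ω).dst e) *
          (d.graph ω).branchProb l ((d.graph ω).dst e') -
            d.rho ^ N * (1 / (d.outDeg (ω e).1 : ℝ))) +
        d.rho ^ N * ∑ ω ∈ K, (1 / (d.outDeg (ω e).1 : ℝ) - d.rho) := by
      rw [Finset.mul_sum, ← Finset.sum_add_distrib]
      exact Finset.sum_congr rfl fun ω _ => by ring
    have hbad : ((d.inStubsOn S).card : ℝ) ≤ D * (M + 1) := by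
      have h3 : S.card ≤ M + 1 := by
        have h4 : S.card ≤ (insert e (insert e' R)).card := Finset.card_image_le
        have h5 := Finset.card_insert_le e (insert e' R)
        have h6 := Finset.card_insert_le e' R
        omega
      exact_mod_cast (card_inStubsOn_le hD S).trans (Nat.mul_le_mul_left D h3)
    have hm : (0 : ℝ) < d.numEdges := by
      have : M ≠ 0 := by omega
      exact_mod_cast (by omega : 0 < d.numEdges)
    have hmR : (d.numEdges : ℝ) / 2 ≤ d.numEdges - R.card := by
      have h3 : 2 * R.card ≤ d.numEdges := by omega
      have h4 : 2 * (R.card : ℝ) ≤ d.numEdges := by exact_mod_cast h3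
      linarith
    have hRM : (R.card : ℝ) ≤ M := by exact_mod_cast (by omega : R.card ≤ M)
    have hfrac : (d.inStubsOn S).card / (d.numEdges - R.card : ℝ) +
        R.card / (d.numEdges - R.card : ℝ) ≤ κ := by
      rw [← add_div, hκ, div_le_div_iff₀ (by linarith) hm]
      have hX : (d.inStubsOn S).card + (R.card : ℝ) ≤ D * (M + 2) + M := by
        have : (0 : ℝ) ≤ D := by positivity
        linarith
      calc _ ≤ (D * (M + 2) + M : ℝ) * d.numEdges := by gcongr
        _ ≤ (D * (M + 2) + M : ℝ) * (2 * (d.numEdges - R.card)) := by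
          gcongr
          linarith
        _ = _ := by ring
    rw [hsplit]
    refine (abs_add_le _ _).trans ?_
    rw [abs_mul, abs_of_nonneg hρN.1]
    have hlast := (mul_le_of_le_one_left (abs_nonneg _) hρN.2).trans hunif
    have hK : (0 : ℝ) ≤ K.card := by positivity
    have := mul_le_mul_of_nonneg_right hfrac hK
    push_cast
    linarith

variable {d} in
lemma sum_outStub_inv_outDeg (h2 : ∀ x, 2 ≤ d.outDeg x) :
    ∑ e : d.OutStub, 1 / (d.outDeg e.1 : ℝ) = n := by
  rw [Fintype.sum_sigma]
  have : ∀ x, ∑ _i : Fin (d.outDeg x), 1 / (d.outDeg x : ℝ) = 1 := fun x => by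
    have : (d.outDeg x : ℝ) ≠ 0 := by exact_mod_cast (two_pos.trans_le (h2 x)).ne'
    simp [this]
  simp only [this, Finset.sum_const, Finset.card_univ, Fintype.card_fin, nsmul_eq_mul, mul_one]

variable {d} in
/-- The second moment of the deviation of `edgeBranchMean`. -/
lemma average_edgeBranchMean_sub_sq_le (h2 : ∀ x, 2 ≤ d.outDeg x) {D s : ℕ}
    (hD : ∀ x, d.inDeg x ≤ D) (hm : 0 < d.numEdges) (hs : 4 * s ≤ d.numEdges) :
    d.average (fun ω => ((d.graph ω).edgeBranchMean s - d.rho ^ s / d.delta) ^ 2) ≤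
      (1 + 4 * (2 * s) * (2 * (D * (2 * s + 2) + 2 * s))) / d.numEdges := by
  have hG : ∀ ω x, 2 ≤ (d.graph ω).outDegree x := fun ω x => by
    rw [graph_outDegree]
    exact h2 x
  have hρ := rho_mem_Icc h2
  have hρs : d.rho ^ s ∈ Set.Icc (0 : ℝ) 1 :=
    ⟨pow_nonneg hρ.1 _, pow_le_one₀ hρ.1 (hρ.2.trans (by norm_num))⟩
  have hw : ∀ e : d.OutStub, 1 / (d.outDeg e.1 : ℝ) ∈ Set.Icc (0 : ℝ) 1 := fun e =>
    Set.Icc_subset_Icc_right (by norm_num) (inv_outDeg_mem_Icc h2 e.1)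
  have hm' : (0 : ℝ) < d.numEdges := by exact_mod_cast hm
  set κ : ℝ := 2 * (D * (2 * s + 2) + 2 * s) / d.numEdges with hκ
  have hκ0 : 0 ≤ κ := by positivity
  set N : ℝ := ((Fintype.card d.Configuration : ℕ) : ℝ) with hN
  have hN0 : 0 < N := by positivity
  set Z : d.Configuration → d.OutStub → ℝ := fun ω e =>
    (d.graph ω).branchProb s ((d.graph ω).dst e) - d.rho ^ s with hZ
  have hZ1 : ∀ ω e, |Z ω e| ≤ 1 := by
    intro ω e
    have h := (d.graph ω).branchProb_mem_Icc (hG ω) s ((d.graph ω).dst e)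
    have h' : ((1 : ℝ) / 2) ^ s ≤ 1 := pow_le_one₀ (by norm_num) (by norm_num)
    rw [abs_le]
    exact ⟨by linarith [h.1, hρs.2], by linarith [h.2, hρs.1]⟩
  -- distinct edges are nearly uncorrelated
  have hcov : ∀ e e' : d.OutStub, e ≠ e' → |∑ ω, Z ω e * Z ω e'| ≤ 4 * (2 * s) * κ * N := by
    intro e e' hee'
    obtain ⟨ω₀⟩ : Nonempty d.Configuration := inferInstance
    have hpair : ∀ k l, k + l ≤ 2 * s → |∑ ω, ((d.graph ω).branchProb k ((d.graph ω).dst e) *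
        (d.graph ω).branchProb l ((d.graph ω).dst e') - d.rho ^ (k + l))| ≤
          2 * s * κ * N := by
      intro k l hkl
      have h := abs_sum_branchProb_mul_sub_le h2 (M := 2 * s) hD (by omega) (k + l) k l rfl ∅ ω₀
        (Finset.notMem_empty e) (Finset.notMem_empty e') hee' (by simpa using hkl)
      rw [matchingCylinder_empty, Finset.card_univ, ← hN] at h
      refine h.trans ?_
      rw [hκ]
      push_cast
      gcongr
      exact_mod_cast hkl
    have h1 := hpair s s (by omega)
    have h3 := hpair s 0 (by omega)
    have h4 := hpair 0 s (by omega)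
    simp only [DirectedMultigraph.branchProb, mul_one, one_mul, add_zero, zero_add] at h3 h4
    have hexp : ∑ ω, Z ω e * Z ω e' =
        ∑ ω, ((d.graph ω).branchProb s ((d.graph ω).dst e) *
          (d.graph ω).branchProb s ((d.graph ω).dst e') - d.rho ^ (s + s)) -
        d.rho ^ s * ∑ ω, ((d.graph ω).branchProb s ((d.graph ω).dst e) - d.rho ^ s) -
        d.rho ^ s * ∑ ω, ((d.graph ω).branchProb s ((d.graph ω).dst e') - d.rho ^ s) := by
      rw [Finset.mul_sum, Finset.mul_sum, ← Finset.sum_sub_distrib, ← Finset.sum_sub_distrib]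
      exact Finset.sum_congr rfl fun ω _ => by simp only [hZ]; ring
    have hsmall : ∀ x : ℝ, |x| ≤ 2 * s * κ * N → |d.rho ^ s * x| ≤ 2 * s * κ * N := fun x hx => by
      rw [abs_mul, abs_of_nonneg hρs.1]
      exact (mul_le_of_le_one_left (abs_nonneg _) hρs.2).trans hx
    have h5 := hsmall _ h3
    have h6 := hsmall _ h4
    have h7 : 0 ≤ 2 * s * κ * N := by positivity
    rw [hexp]
    rw [abs_le] at *
    exact ⟨by linarith, by linarith⟩
  have hdev : ∀ ω, (d.graph ω).edgeBranchMean s - d.rho ^ s / d.delta =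
      1 / d.numEdges * ∑ e : d.OutStub, 1 / (d.outDeg e.1 : ℝ) * Z ω e := by
    intro ω
    simp only [DirectedMultigraph.edgeBranchMean, hZ, mul_sub, Finset.sum_sub_distrib,
      ← Finset.sum_mul, sum_outStub_inv_outDeg h2, graph_outDegree, card_outStub, delta]
    congr 1
    · rw [div_div_eq_mul_div]
      ring
  have hsq : ∑ ω, ((d.graph ω).edgeBranchMean s - d.rho ^ s / d.delta) ^ 2 =
      (1 / d.numEdges) ^ 2 * ∑ e : d.OutStub, ∑ e' : d.OutStub,
        1 / (d.outDeg e.1 : ℝ) * (1 / (d.outDeg e'.1 : ℝ)) * ∑ ω, Z ω e * Z ω e' := by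
    have : ∀ ω, ((d.graph ω).edgeBranchMean s - d.rho ^ s / d.delta) ^ 2 =
        (1 / d.numEdges) ^ 2 * ∑ e : d.OutStub, ∑ e' : d.OutStub,
          1 / (d.outDeg e.1 : ℝ) * (1 / (d.outDeg e'.1 : ℝ)) * (Z ω e * Z ω e') := by
      intro ω
      rw [hdev, mul_pow, sq (∑ e : d.OutStub, _), Finset.sum_mul_sum]
      congr 1
      exact Finset.sum_congr rfl fun e _ => Finset.sum_congr rfl fun e' _ => by ring
    simp only [this]
    rw [← Finset.mul_sum, Finset.sum_comm]
    congr 1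
    refine Finset.sum_congr rfl fun e _ => ?_
    rw [Finset.sum_comm]
    exact Finset.sum_congr rfl fun e' _ => by rw [Finset.mul_sum]
  have hterm : ∀ e e' : d.OutStub, 1 / (d.outDeg e.1 : ℝ) * (1 / (d.outDeg e'.1 : ℝ)) *
      ∑ ω, Z ω e * Z ω e' ≤ (if e = e' then N else 0) + 4 * (2 * s) * κ * N := by
    intro e e'
    have h1 : |∑ ω, Z ω e * Z ω e'| ≤ (if e = e' then N else 0) + 4 * (2 * s) * κ * N := by
      split_ifs with h
      · have h3 : |∑ ω, Z ω e * Z ω e'| ≤ ∑ _ω : d.Configuration, (1 : ℝ) :=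
          (Finset.abs_sum_le_sum_abs _ _).trans (Finset.sum_le_sum fun ω _ => by
            rw [abs_mul]
            exact mul_le_one₀ (hZ1 ω e) (abs_nonneg _) (hZ1 ω e'))
        rw [Finset.sum_const, Finset.card_univ, nsmul_eq_mul, mul_one, ← hN] at h3
        have : 0 ≤ 4 * (2 * s) * κ * N := by positivity
        linarith
      · rw [zero_add]
        exact hcov e e' h
    refine (le_abs_self _).trans ?_
    have hww := mul_nonneg (hw e).1 (hw e').1
    rw [abs_mul, abs_of_nonneg hww]
    exact (mul_le_of_le_one_left (abs_nonneg _)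
      (mul_le_one₀ (hw e).2 (hw e').1 (hw e').2)).trans h1
  rw [average, hsq]
  calc _ ≤ 1 / N * ((1 / d.numEdges) ^ 2 * ∑ e : d.OutStub, ∑ e' : d.OutStub,
        ((if e = e' then N else 0) + 4 * (2 * s) * κ * N)) := by
        gcongr with e _ e' _
        exact hterm e e'
    _ = 1 / N * ((1 / d.numEdges) ^ 2 *
        (d.numEdges * N + d.numEdges * (d.numEdges * (4 * (2 * s) * κ * N)))) := by
        simp only [Finset.sum_add_distrib, Finset.sum_ite_eq, Finset.mem_univ, if_true,
          Finset.sum_const, Finset.card_univ, card_outStub, nsmul_eq_mul]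
    _ = _ := by
        rw [hκ]
        field_simp

end BiDegreeSequence

namespace BiDegreeSequence

variable {n : ℕ} {d : BiDegreeSequence n}

/-! ### The exploration by two walkers is unlikely to leave a tree -/

lemma endpoint_eq_of_mem_matchingCylinder {R : Finset d.OutStub} {ω₀ ω : d.Configuration}
    (hω : ω ∈ matchingCylinder R ω₀) (x₀ : Fin n) {α : List d.OutStub} (hα : α.toFinset ⊆ R) :
    (d.graph ω).endpoint x₀ α = (d.graph ω₀).endpoint x₀ α := by
  cases α with
  | nil => rfl
  | cons e α => exact congrArg Sigma.fst (mem_matchingCylinder.1 hω e (hα (by simp)))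

lemma isTreelike_iff_of_mem_matchingCylinder {ω₀ ω : d.Configuration} {α β : List d.OutStub}
    (hω : ω ∈ matchingCylinder (α ++ β).toFinset ω₀) (x₀ : Fin n) :
    (d.graph ω).IsTreelike x₀ α β ↔ (d.graph ω₀).IsTreelike x₀ α β := by
  have h : ∀ e ∈ α ++ β, (d.graph ω).dst e = (d.graph ω₀).dst e := fun e he =>
    congrArg Sigma.fst (mem_matchingCylinder.1 hω e (List.mem_toFinset.2 he))
  refine and_congr (forall₂_congr fun e he => by rw [h e he]) ?_
  exact forall₂_congr fun e he => forall₂_congr fun e' he' => by rw [h e he, h e' he']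

/-- If exploring a tree for `k` more steps from any longer pair of walks fails with probability at
most `c`, then traversing the edge `e` first adds at most the probability that `e` is a new edge
and leads to a known vertex. -/
lemma sum_collideProb_le_of_toFinset_eq_insert (h2 : ∀ x, 2 ≤ d.outDeg x) {D M k : ℕ} {c : ℝ}
    (hD : ∀ x, d.inDeg x ≤ D) (hM : 2 * M ≤ d.numEdges) (hc : 0 ≤ c) (x₀ : Fin n)
    (ω₀ : d.Configuration) {α β α' β' : List d.OutStub} {e : d.OutStub}
    (hα' : (α' ++ β').toFinset = insert e (α ++ β).toFinset) (hlen : α.length + β.length + 1 ≤ M)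
    (htree : (d.graph ω₀).IsTreelike x₀ α β)
    (ih : ∀ ω₁ : d.Configuration, (d.graph ω₁).IsTreelike x₀ α' β' →
      ∑ ω ∈ matchingCylinder (α' ++ β').toFinset ω₁, (d.graph ω).collideProb x₀ k α' β' ≤
        c * (matchingCylinder (α' ++ β').toFinset ω₁).card) :
    ∑ ω ∈ matchingCylinder (α ++ β).toFinset ω₀, (d.graph ω).collideProb x₀ k α' β' ≤
      (c + 2 * (D * M) / d.numEdges) * (matchingCylinder (α ++ β).toFinset ω₀).card := by
  have hG : ∀ ω x, 0 < (d.graph ω).outDegree x := fun ω x => by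
    rw [graph_outDegree]
    exact two_pos.trans_le (h2 x)
  have hcoll := fun ω => (d.graph ω).collideProb_mem_Icc (hG ω) x₀ k α' β'
  set R := (α ++ β).toFinset with hR
  have hmem : ∀ f, f ∈ α' ++ β' ↔ f = e ∨ f ∈ α ++ β := fun f => by
    rw [← List.mem_toFinset, hα', Finset.mem_insert, hR, List.mem_toFinset]
  have hRcard : R.card ≤ α.length + β.length := by
    rw [← List.length_append]
    exact List.toFinset_card_le _
  by_cases he : e ∈ R
  · rw [Finset.insert_eq_of_mem he] at hα'
    rw [hα'] at ih
    have he' : e ∈ α ++ β := List.mem_toFinset.1 he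
    have hmem' : ∀ f, f ∈ α' ++ β' ↔ f ∈ α ++ β := fun f => by
      rw [hmem]
      exact ⟨fun h => h.elim (fun h => h ▸ he') id, Or.inr⟩
    refine (ih ω₀ ⟨fun f hf => htree.1 f ((hmem' f).1 hf), fun f hf f' hf' =>
      htree.2 f ((hmem' f).1 hf) f' ((hmem' f').1 hf')⟩).trans ?_
    exact mul_le_mul_of_nonneg_right (le_add_of_nonneg_right (by positivity))
      (Nat.cast_nonneg _)
  -- the vertices that have been visited
  set S : Finset (Fin n) := insert x₀ (R.image (d.graph ω₀).dst) with hS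
  have hreveal := abs_sum_matchingCylinder_le ω₀ he (d.inStubsOn S) hc
    (g := fun ω => (d.graph ω).collideProb x₀ k α' β')
    (fun ω => by
      rw [abs_of_nonneg (hcoll ω).1]
      exact (hcoll ω).2)
    (fun ω₁ hω₁ hnew => by
      have hnew' : (d.graph ω₁).dst e ∉ S := fun h =>
        hnew (Finset.mem_filter.2 ⟨Finset.mem_univ _, h⟩)
      have htree' := (isTreelike_iff_of_mem_matchingCylinder hω₁ x₀).2 htree
      have hdst : ∀ f ∈ α ++ β, (d.graph ω₁).dst f ≠ (d.graph ω₁).dst e := fun f hf h => by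
        have h' : (d.graph ω₁).dst f = (d.graph ω₀).dst f :=
          congrArg Sigma.fst (mem_matchingCylinder.1 hω₁ f (List.mem_toFinset.2 hf))
        rw [← h, h'] at hnew'
        exact hnew' (Finset.mem_insert_of_mem
          (Finset.mem_image_of_mem _ (List.mem_toFinset.2 hf)))
      rw [abs_of_nonneg (Finset.sum_nonneg fun ω _ => (hcoll ω).1), ← hα']
      refine ih ω₁ ⟨fun f hf => ?_, fun f hf f' hf' h => ?_⟩
      · rcases (hmem f).1 hf with rfl | hf
        · exact fun h => hnew' (h ▸ Finset.mem_insert_self _ _)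
        · exact htree'.1 f hf
      · rcases (hmem f).1 hf with hfe | hf <;> rcases (hmem f').1 hf' with hfe' | hf'
        · rw [hfe, hfe']
        · exact absurd (hfe ▸ h.symm) (hdst f' hf')
        · exact absurd (hfe' ▸ h) (hdst f hf)
        · exact htree'.2 f hf f' hf' h)
  rw [abs_of_nonneg (Finset.sum_nonneg fun ω _ => (hcoll ω).1), card_outStub] at hreveal
  refine hreveal.trans (mul_le_mul_of_nonneg_right (add_le_add le_rfl ?_) (by positivity))
  have hbad : ((d.inStubsOn S).card : ℝ) ≤ D * M := by
    have h3 : S.card ≤ M := by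
      have h4 : S.card ≤ (R.image (d.graph ω₀).dst).card + 1 := Finset.card_insert_le _ _
      have h5 : (R.image (d.graph ω₀).dst).card ≤ R.card := Finset.card_image_le
      omega
    exact_mod_cast (card_inStubsOn_le hD S).trans (Nat.mul_le_mul_left D h3)
  have hm : (0 : ℝ) < d.numEdges := by exact_mod_cast (by omega : 0 < d.numEdges)
  have hmR : (d.numEdges : ℝ) / 2 ≤ d.numEdges - R.card := by
    have h3 : 2 * R.card ≤ d.numEdges := by omega
    have h4 : 2 * (R.card : ℝ) ≤ d.numEdges := by exact_mod_cast h3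
    linarith
  rw [div_le_div_iff₀ (by linarith) hm]
  calc _ ≤ (D * M : ℝ) * d.numEdges := by gcongr
    _ ≤ (D * M : ℝ) * (2 * (d.numEdges - R.card)) := by
      gcongr
      linarith
    _ = _ := by ring

/-- A union bound over the `k` steps, each of which leads to a known vertex with probability at most
`2 D M / m`. -/
lemma sum_collideProb_le (h2 : ∀ x, 2 ≤ d.outDeg x) {D M : ℕ}
    (hD : ∀ x, d.inDeg x ≤ D) (hM : 2 * M ≤ d.numEdges) (x₀ : Fin n) (k : ℕ)
    (ω₀ : d.Configuration) (α β : List d.OutStub) (hlen : α.length + β.length + k ≤ M)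
    (htree : (d.graph ω₀).IsTreelike x₀ α β) :
    ∑ ω ∈ matchingCylinder (α ++ β).toFinset ω₀, (d.graph ω).collideProb x₀ k α β ≤
      k * (2 * (D * M) / d.numEdges : ℝ) * (matchingCylinder (α ++ β).toFinset ω₀).card := by
  induction k generalizing ω₀ α β with
  | zero =>
    refine (Finset.sum_eq_zero fun ω hω => ?_).trans_le (by simp)
    rw [DirectedMultigraph.collideProb,
      if_pos ((isTreelike_iff_of_mem_matchingCylinder hω x₀).2 htree)]
  | succ k ih =>
    set κ : ℝ := 2 * (D * M) / d.numEdges with hκ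
    set K := matchingCylinder (α ++ β).toFinset ω₀ with hK
    have hG : ∀ x, 0 < (d.graph ω₀).outDegree x := fun x => by
      rw [graph_outDegree]
      exact two_pos.trans_le (h2 x)
    have hsum : ∑ ω ∈ K, (d.graph ω).collideProb x₀ (k + 1) α β =
        ((d.graph ω₀).stepMean (fun e => ∑ ω ∈ K, (d.graph ω).collideProb x₀ k (e :: α) β)
            ((d.graph ω₀).endpoint x₀ α) +
          (d.graph ω₀).stepMean (fun e => ∑ ω ∈ K, (d.graph ω).collideProb x₀ k α (e :: β))
            ((d.graph ω₀).endpoint x₀ β)) / 2 := by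
      rw [DirectedMultigraph.stepMean_sum, DirectedMultigraph.stepMean_sum,
        ← Finset.sum_add_distrib, Finset.sum_div]
      refine Finset.sum_congr rfl fun ω hω => ?_
      rw [DirectedMultigraph.collideProb,
        if_pos ((isTreelike_iff_of_mem_matchingCylinder hω x₀).2 htree),
        endpoint_eq_of_mem_matchingCylinder hω x₀ (α := α) (by simp),
        endpoint_eq_of_mem_matchingCylinder hω x₀ (α := β) (by simp)]
      rfl
    have hα := (d.graph ω₀).stepMean_le (hG ((d.graph ω₀).endpoint x₀ α)) fun e _ =>
      sum_collideProb_le_of_toFinset_eq_insert h2 hD hM (k := k) (c := k * κ) (by positivity) x₀ ω₀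
        (α' := e :: α) (β' := β) (e := e) (by simp) (by omega) htree
        fun ω₁ h => ih ω₁ (e :: α) β (by simp only [List.length_cons]; omega) h
    have hβ := (d.graph ω₀).stepMean_le (hG ((d.graph ω₀).endpoint x₀ β)) fun e _ =>
      sum_collideProb_le_of_toFinset_eq_insert h2 hD hM (k := k) (c := k * κ) (by positivity) x₀ ω₀
        (α' := α) (β' := e :: β) (e := e) (by ext; simp) (by omega) htree
        fun ω₁ h => ih ω₁ α (e :: β) (by simp only [List.length_cons]; omega) h
    rw [hsum]
    push_cast
    rw [← hκ, ← hK] at hα hβ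
    linarith

lemma average_const_mul (c : ℝ) (f : d.Configuration → ℝ) :
    d.average (fun ω => c * f ω) = c * d.average f := by
  simp only [average, ← Finset.mul_sum]
  ring

lemma average_mono {f g : d.Configuration → ℝ} (h : ∀ ω, f ω ≤ g ω) :
    d.average f ≤ d.average g := by
  unfold average
  gcongr with ω
  exact h ω

lemma average_const (c : ℝ) : d.average (fun _ => c) = c := by
  have : (Fintype.card d.Configuration : ℝ) ≠ 0 := by positivity
  simp only [average, Finset.sum_const, Finset.card_univ, nsmul_eq_mul]
  field_simp

lemma average_add (f g : d.Configuration → ℝ) :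
    d.average (fun ω => f ω + g ω) = d.average f + d.average g := by
  simp only [average, Finset.sum_add_distrib, mul_add]

lemma average_finsetSum {ι : Type} (s : Finset ι) (f : ι → d.Configuration → ℝ) :
    d.average (fun ω => ∑ i ∈ s, f i ω) = ∑ i ∈ s, d.average (f i) := by
  simp only [average, Finset.mul_sum]
  rw [Finset.sum_comm]

lemma edgeCollideProb_mem_Icc (h2 : ∀ x, 2 ≤ d.outDeg x) (ω : d.Configuration) (k : ℕ) :
    (d.graph ω).edgeCollideProb k ∈ Set.Icc (0 : ℝ) 1 := by
  have h := fun e : d.OutStub => (d.graph ω).collideProb_mem_Icc (fun x => by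
    rw [graph_outDegree]
    exact two_pos.trans_le (h2 x)) ((d.graph ω).src e) k [] [e]
  refine ⟨mul_nonneg (by positivity) (Finset.sum_nonneg fun e _ => (h e).1), ?_⟩
  rw [DirectedMultigraph.edgeCollideProb, one_div_mul_eq_div]
  refine div_le_one_of_le₀ ?_ (by positivity)
  refine (Finset.sum_le_card_nsmul _ _ 1 fun e _ => (h e).2).trans ?_
  simp

lemma average_edgeCollideProb_le (h2 : ∀ x, 2 ≤ d.outDeg x) {D : ℕ} (hD : ∀ x, d.inDeg x ≤ D)
    (hD1 : 1 ≤ D) (hm : 0 < d.numEdges) (k : ℕ) :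
    d.average (fun ω => (d.graph ω).edgeCollideProb k) ≤ 2 * D * (k + 1) ^ 2 / d.numEdges := by
  have hm' : (0 : ℝ) < d.numEdges := by exact_mod_cast hm
  have hD' : (1 : ℝ) ≤ D := by exact_mod_cast hD1
  by_cases hk : 2 * (k + 1) ≤ d.numEdges
  swap
  -- for `k` of order `m` the bound exceeds one
  · refine (average_mono fun ω => (edgeCollideProb_mem_Icc h2 ω k).2).trans ?_
    rw [average_const, le_div_iff₀ hm', one_mul]
    have h3 : (d.numEdges : ℝ) ≤ 2 * (k + 1) := by exact_mod_cast (not_le.1 hk).le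
    have h4 : (0 : ℝ) ≤ k := by positivity
    nlinarith [mul_nonneg (sub_nonneg.2 hD') (sq_nonneg ((k : ℝ) + 1))]
  have hedge : ∀ e : d.OutStub, d.average (fun ω => (d.graph ω).collideProb e.1 k [] [e]) ≤
      2 * D * (k + 1) ^ 2 / d.numEdges := by
    intro e
    obtain ⟨ω₀⟩ : Nonempty d.Configuration := inferInstance
    have htree : (d.graph ω₀).IsTreelike e.1 [] [] := ⟨by simp, by simp⟩
    have h := sum_collideProb_le_of_toFinset_eq_insert h2 hD hk (k := k)
      (c := k * (2 * (D * (k + 1 : ℕ)) / d.numEdges)) (by positivity) e.1 ω₀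
      (α' := []) (β' := [e]) (e := e) (by simp) (by simp) htree
      fun ω₁ h => sum_collideProb_le h2 hD hk e.1 k ω₁ [] [e]
        (by simp only [List.length_nil, List.length_singleton]; omega) h
    simp only [List.append_nil, List.toFinset_nil, matchingCylinder_empty, Finset.card_univ] at h
    have hN : (0 : ℝ) < Fintype.card d.Configuration := by positivity
    rw [average, one_div_mul_eq_div, div_le_iff₀ hN]
    refine h.trans_eq ?_
    push_cast
    ring
  have hexp : d.average (fun ω => (d.graph ω).edgeCollideProb k) =
      1 / d.numEdges * ∑ e : d.OutStub, d.average fun ω =>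
        (d.graph ω).collideProb e.1 k [] [e] := by
    simp only [DirectedMultigraph.edgeCollideProb]
    rw [average_const_mul, average_finsetSum, card_outStub]
    rfl
  have hsum := Finset.sum_le_card_nsmul (Finset.univ : Finset d.OutStub) _ _ fun e _ => hedge e
  rw [Finset.card_univ, card_outStub, nsmul_eq_mul] at hsum
  rw [hexp, one_div_mul_eq_div, div_le_iff₀ hm']
  linarith

end BiDegreeSequence

/-! ### Convergence in mean -/

lemma sum_range_le_sum_range_add {x : ℕ → ℝ} (h0 : ∀ j, 0 ≤ x j) (h1 : ∀ j, x j ≤ (1 / 2) ^ j)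
    (N S : ℕ) : ∑ j ∈ Finset.range N, x j ≤ ∑ j ∈ Finset.range S, x j + 2 * (1 / 2) ^ S := by
  have hS : ∑ j ∈ Finset.range N, x j ≤ ∑ j ∈ Finset.range (S + N), x j :=
    Finset.sum_le_sum_of_subset_of_nonneg (Finset.range_mono (Nat.le_add_left _ _))
      fun j _ _ => h0 j
  refine hS.trans ?_
  rw [Finset.sum_range_add]
  have h2 : ∑ i ∈ Finset.range N, x (S + i) ≤
      ∑ i ∈ Finset.range N, (1 / 2 : ℝ) ^ S * (1 / 2) ^ i :=
    Finset.sum_le_sum fun i _ => (h1 _).trans_eq (pow_add _ _ _)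
  rw [← Finset.mul_sum] at h2
  have h3 := mul_le_mul_of_nonneg_left (sum_geometric_two_le N)
    (by positivity : (0 : ℝ) ≤ (1 / 2) ^ S)
  linarith

namespace BiDegreeSequence

variable {n : ℕ} {d : BiDegreeSequence n}

lemma two_mul_le_numEdges (h2 : ∀ x, 2 ≤ d.outDeg x) : 2 * n ≤ d.numEdges := by
  have := Finset.card_nsmul_le_sum Finset.univ d.outDeg 2 fun x _ => h2 x
  simpa [numEdges, mul_comm] using this

variable (d) in
/-- The limit of the probability that the walkers started from the ends of a uniformly random edge
meet within `k` steps: the sum over the number `j` of steps made by the one who is caught. -/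
def limitMeetProb (k : ℕ) : ℝ :=
  ∑ j ∈ Finset.range (k + 1), if 1 + 2 * j ≤ k then
    (catalan j : ℝ) * (1 / 2) ^ (1 + 2 * j) * (d.rho ^ j / d.delta) else 0

/-- The term `j = 0` of `limitMeetProb` is the summand `1 / (2 δ)` that `phi` lists separately. -/
lemma phi_eq (t : ℝ) :
    d.phi t = 1 - ∑' k, poissonWeight t k * d.limitMeetProb k := by
  rw [phi, ← tsum_mul_left]
  congr 1
  refine tsum_congr fun k => ?_
  rw [mul_left_comm, poissonWeight]
  congr 1
  rw [limitMeetProb, ← Finset.sum_filter]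
  rcases Nat.eq_zero_or_pos k with rfl | hk
  · simp
  have h : (Finset.range (k + 1)).filter (fun j => 1 + 2 * j ≤ k) =
      insert 0 (Finset.Icc 1 ((k - 1) / 2)) := by
    ext j
    simp only [Finset.mem_filter, Finset.mem_range, Finset.mem_insert, Finset.mem_Icc]
    omega
  rw [h, Finset.sum_insert (by simp), if_pos hk, mul_add, Finset.mul_sum, add_comm]
  congr 1
  · simp only [catalan_zero, Nat.cast_one, mul_zero, add_zero, pow_one, pow_zero]
    ring
  · refine Finset.sum_congr rfl fun j hj => ?_
    rw [Finset.mem_Icc] at hj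
    rw [if_pos (by omega)]
    simp only [one_div, inv_pow, pow_add]
    ring

lemma one_div_delta_mem_Icc (h2 : ∀ x, 2 ≤ d.outDeg x) : 1 / d.delta ∈ Set.Icc (0 : ℝ) 1 := by
  have h : (n : ℝ) ≤ d.numEdges := by
    exact_mod_cast (by have := two_mul_le_numEdges h2; omega : n ≤ d.numEdges)
  rw [delta, one_div_div]
  exact ⟨by positivity, div_le_one_of_le₀ h (by positivity)⟩

/-- The walkers meet within `k` steps with nearly the limiting probability unless they fail to
explore a tree; late meetings are unlikely in any graph, so only finitely many of the empirical
means matter. -/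
lemma abs_edgeMeetProb_sub_limitMeetProb_le (h2 : ∀ x, 2 ≤ d.outDeg x) (ω : d.Configuration)
    (k S : ℕ) : |(d.graph ω).edgeMeetProb k - d.limitMeetProb k| ≤
      (d.graph ω).edgeCollideProb k + (∑ j ∈ Finset.range S,
        |(d.graph ω).edgeBranchMean j - d.rho ^ j / d.delta| + 2 * (1 / 2) ^ S) := by
  have hG : ∀ x, 2 ≤ (d.graph ω).outDegree x := fun x => by
    rw [graph_outDegree]
    exact h2 x
  have hρ := rho_mem_Icc h2
  have hδ := one_div_delta_mem_Icc h2
  have hw : ∀ j, (catalan j : ℝ) * (1 / 2) ^ (1 + 2 * j) ∈ Set.Icc (0 : ℝ) 1 := by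
    intro j
    refine ⟨by positivity, ?_⟩
    have h4 : (catalan j : ℝ) ≤ 4 ^ j := by exact_mod_cast catalan_le_four_pow j
    calc (catalan j : ℝ) * (1 / 2) ^ (1 + 2 * j) ≤ 4 ^ j * (1 / 2) ^ (1 + 2 * j) := by gcongr
      _ = 1 / 2 := by
        rw [pow_add, pow_mul, mul_left_comm, ← mul_pow]
        norm_num
      _ ≤ 1 := by norm_num
  have hY : ∀ j, (d.graph ω).edgeBranchMean j ∈ Set.Icc (0 : ℝ) ((1 / 2) ^ j) := by
    intro j
    have h1 : ∀ e : d.OutStub, 1 / ((d.graph ω).outDegree ((d.graph ω).src e) : ℝ) *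
        (d.graph ω).branchProb j ((d.graph ω).dst e) ∈ Set.Icc (0 : ℝ) ((1 / 2) ^ j) := by
      intro e
      have h3 := (d.graph ω).branchProb_mem_Icc hG j ((d.graph ω).dst e)
      have h4 := inv_outDeg_mem_Icc h2 e.1
      rw [graph_outDegree]
      exact ⟨mul_nonneg h4.1 h3.1,
        (mul_le_of_le_one_left h3.1 (h4.2.trans (by norm_num))).trans h3.2⟩
    refine ⟨mul_nonneg (by positivity) (Finset.sum_nonneg fun e _ => (h1 e).1), ?_⟩
    rw [DirectedMultigraph.edgeBranchMean, one_div_mul_eq_div]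
    refine div_le_of_le_mul₀ (by positivity) (by positivity) ?_
    refine (Finset.sum_le_card_nsmul _ _ _ fun e _ => (h1 e).2).trans_eq ?_
    rw [Finset.card_univ, nsmul_eq_mul, mul_comm]
  have hZ : ∀ j, d.rho ^ j / d.delta ∈ Set.Icc (0 : ℝ) ((1 / 2) ^ j) := by
    intro j
    have h3 : d.rho ^ j ≤ (1 / 2) ^ j := pow_le_pow_left₀ hρ.1 hρ.2 j
    have h4 : 0 ≤ d.rho ^ j := pow_nonneg hρ.1 j
    rw [← mul_one_div (d.rho ^ j)]
    exact ⟨mul_nonneg h4 hδ.1, (mul_le_of_le_one_right h4 hδ.2).trans h3⟩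
  have hdiff : |(∑ j ∈ Finset.range (k + 1), if 1 + 2 * j ≤ k then
      (catalan j : ℝ) * (1 / 2) ^ (1 + 2 * j) * (d.graph ω).edgeBranchMean j else 0) -
        d.limitMeetProb k| ≤ ∑ j ∈ Finset.range (k + 1),
          |(d.graph ω).edgeBranchMean j - d.rho ^ j / d.delta| := by
    rw [limitMeetProb, ← Finset.sum_sub_distrib]
    refine (Finset.abs_sum_le_sum_abs _ _).trans (Finset.sum_le_sum fun j _ => ?_)
    split_ifs
    · rw [← mul_sub, abs_mul, abs_of_nonneg (hw j).1]
      exact mul_le_of_le_one_left (abs_nonneg _) (hw j).2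
    · simp
  have htail := sum_range_le_sum_range_add
    (x := fun j => |(d.graph ω).edgeBranchMean j - d.rho ^ j / d.delta|)
    (fun j => abs_nonneg _) (fun j => by
      rw [abs_le]
      exact ⟨by linarith [(hY j).1, (hZ j).2], by linarith [(hY j).2, (hZ j).1]⟩) (k + 1) S
  have hmeet := (d.graph ω).abs_edgeMeetProb_sub_le (fun x => two_pos.trans_le (hG x)) k
  linarith [abs_sub_le ((d.graph ω).edgeMeetProb k) (∑ j ∈ Finset.range (k + 1),
    if 1 + 2 * j ≤ k then (catalan j : ℝ) * (1 / 2) ^ (1 + 2 * j) *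
      (d.graph ω).edgeBranchMean j else 0) (d.limitMeetProb k)]

lemma limitMeetProb_mem_Icc (h2 : ∀ x, 2 ≤ d.outDeg x) (k : ℕ) :
    d.limitMeetProb k ∈ Set.Icc (0 : ℝ) 4 := by
  obtain ⟨ω⟩ : Nonempty d.Configuration := inferInstance
  have hρ := rho_mem_Icc h2
  have hδ := one_div_delta_mem_Icc h2
  have h0 : 0 ≤ d.limitMeetProb k := by
    refine Finset.sum_nonneg fun j _ => ?_
    split_ifs
    · rw [← mul_one_div (d.rho ^ j)]
      exact mul_nonneg (by positivity) (mul_nonneg (pow_nonneg hρ.1 j) hδ.1)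
    · exact le_rfl
  have h := abs_edgeMeetProb_sub_limitMeetProb_le h2 ω k 0
  have h3 := (edgeCollideProb_mem_Icc h2 ω k).2
  have h4 := ((d.graph ω).edgeMeetProb_mem_Icc (fun x => by
    rw [graph_outDegree]
    exact two_pos.trans_le (h2 x)) k).2
  simp only [Finset.range_zero, Finset.sum_empty, pow_zero] at h
  exact ⟨h0, by linarith [(abs_le.1 h).1]⟩

/-- The error for a fixed matching: the probability of leaving a tree, the fluctuations of the first
`S` empirical means, and the probability of a late meeting. -/
lemma abs_voterExpectation_sub_le (h2 : ∀ x, 2 ≤ d.outDeg x) (hm : 0 < d.numEdges)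
    (u : unitInterval) {t : ℝ} (ht : 0 ≤ t) (ω : d.Configuration) (S : ℕ) :
    |(d.graph ω).voterExpectation u t (d.graph ω).discordantDensity -
        2 * (u : ℝ) * (1 - u) * d.phi t| ≤
      ∑' k, poissonWeight t k * (d.graph ω).edgeCollideProb k + (∑ j ∈ Finset.range S,
        |(d.graph ω).edgeBranchMean j - d.rho ^ j / d.delta| + 2 * (1 / 2) ^ S) := by
  have hG : ∀ x, 0 < (d.graph ω).outDegree x := fun x => by
    rw [graph_outDegree]
    exact two_pos.trans_le (h2 x)
  have : Nonempty d.OutStub := Fintype.card_pos_iff.1 (by rwa [card_outStub])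
  set c : ℝ := 2 * (u : ℝ) * (1 - u) with hc
  have hu0 := u.2.1
  have hu1 := u.2.2
  have hc0 : 0 ≤ c := mul_nonneg (by positivity) (by linarith)
  have hc1 : c ≤ 1 := by nlinarith [sq_nonneg (2 * (u : ℝ) - 1)]
  set b : ℝ := ∑ j ∈ Finset.range S,
    |(d.graph ω).edgeBranchMean j - d.rho ^ j / d.delta| + 2 * (1 / 2) ^ S with hb
  have hP := hasSum_poissonWeight t
  have hP0 := fun k => poissonWeight_nonneg ht k
  have hlim : Summable fun k => poissonWeight t k * d.limitMeetProb k :=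
    Summable.of_nonneg_of_le (fun k => mul_nonneg (hP0 k) (limitMeetProb_mem_Icc h2 k).1)
      (fun k => mul_le_mul_of_nonneg_left (limitMeetProb_mem_Icc h2 k).2 (hP0 k))
      (hP.summable.mul_right 4)
  have hcol : Summable fun k => poissonWeight t k * (d.graph ω).edgeCollideProb k :=
    Summable.of_nonneg_of_le (fun k => mul_nonneg (hP0 k) (edgeCollideProb_mem_Icc h2 ω k).1)
      (fun k => mul_le_of_le_one_right (hP0 k) (edgeCollideProb_mem_Icc h2 ω k).2) hP.summable
  have h1 := (d.graph ω).hasSum_voterExpectation_discordantDensity hG u ht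
  have h3 : HasSum (fun k => poissonWeight t k * (c * (1 - d.limitMeetProb k))) (c * d.phi t) := by
    rw [phi_eq]
    exact ((hP.sub hlim.hasSum).mul_left c).congr_fun fun k => by ring
  have h4 := h1.sub h3
  have h5 : HasSum (fun k => poissonWeight t k * (d.graph ω).edgeCollideProb k +
      poissonWeight t k * b)
      (∑' k, poissonWeight t k * (d.graph ω).edgeCollideProb k + b) := by
    simpa using hcol.hasSum.add (hP.mul_right b)
  have hbound : ∀ k, ‖poissonWeight t k * (c * (1 - (d.graph ω).edgeMeetProb k)) -
      poissonWeight t k * (c * (1 - d.limitMeetProb k))‖ ≤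
      poissonWeight t k * (d.graph ω).edgeCollideProb k + poissonWeight t k * b := by
    intro k
    have h6 := abs_edgeMeetProb_sub_limitMeetProb_le h2 ω k S
    rw [show poissonWeight t k * (c * (1 - (d.graph ω).edgeMeetProb k)) -
      poissonWeight t k * (c * (1 - d.limitMeetProb k)) =
      -(poissonWeight t k * (c * ((d.graph ω).edgeMeetProb k - d.limitMeetProb k))) by ring,
      norm_neg, Real.norm_eq_abs, abs_mul, abs_mul, abs_of_nonneg (hP0 k), abs_of_nonneg hc0,
      ← mul_add]
    gcongr
    · exact hP0 k
    · exact (mul_le_of_le_one_left (abs_nonneg _) hc1).trans h6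
  have h7 := h4.norm_le_of_bounded h5 hbound
  rwa [Real.norm_eq_abs] at h7

lemma average_abs_le_sqrt (f : d.Configuration → ℝ) :
    d.average (fun ω => |f ω|) ≤ √(d.average fun ω => f ω ^ 2) := by
  refine Real.le_sqrt_of_sq_le ?_
  have hN : (0 : ℝ) < Fintype.card d.Configuration := by positivity
  have h := sq_sum_le_card_mul_sum_sq (s := Finset.univ) (f := fun ω : d.Configuration => |f ω|)
  simp only [sq_abs, Finset.card_univ] at h
  unfold average
  rw [mul_pow]
  calc _ ≤ (1 / (Fintype.card d.Configuration : ℝ)) ^ 2 *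
        ((Fintype.card d.Configuration : ℝ) * ∑ ω, f ω ^ 2) := by gcongr
    _ = _ := by field_simp

lemma average_abs_voterExpectation_sub_le (h2 : ∀ x, 2 ≤ d.outDeg x) {D S : ℕ}
    (hD : ∀ x, d.inDeg x ≤ D) (hD1 : 1 ≤ D) (hm : 0 < d.numEdges) (hS : 4 * S ≤ d.numEdges)
    (u : unitInterval) {t : ℝ} (ht : 0 ≤ t) :
    d.average (fun ω => |(d.graph ω).voterExpectation u t (d.graph ω).discordantDensity -
        2 * (u : ℝ) * (1 - u) * d.phi t|) ≤
      2 * D * (4 * t ^ 2 + 6 * t + 1) / d.numEdges + (∑ s ∈ Finset.range S,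
        √((1 + 4 * (2 * s) * (2 * (D * (2 * s + 2) + 2 * s))) / d.numEdges) +
          2 * (1 / 2) ^ S) := by
  refine (average_mono fun ω => abs_voterExpectation_sub_le h2 hm u ht ω S).trans ?_
  rw [average_add, average_add, average_const, average_finsetSum]
  refine add_le_add ?_ (add_le_add (Finset.sum_le_sum fun s hs => ?_) le_rfl)
  · have hP := hasSum_poissonWeight t
    have hP0 := fun k => poissonWeight_nonneg ht k
    have hcol : ∀ ω : d.Configuration,
        Summable fun k => poissonWeight t k * (d.graph ω).edgeCollideProb k := fun ω =>
      Summable.of_nonneg_of_le (fun k => mul_nonneg (hP0 k) (edgeCollideProb_mem_Icc h2 ω k).1)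
        (fun k => mul_le_of_le_one_right (hP0 k) (edgeCollideProb_mem_Icc h2 ω k).2) hP.summable
    have h1 := (hasSum_sum fun ω (_ : ω ∈ Finset.univ) => (hcol ω).hasSum).mul_left
      (1 / (Fintype.card d.Configuration : ℝ))
    have h3 := (hasSum_poissonWeight_mul_sq t).mul_left (2 * D / d.numEdges : ℝ)
    refine (hasSum_le (fun k => ?_) h1 h3).trans_eq (by ring)
    have h4 := mul_le_mul_of_nonneg_left (average_edgeCollideProb_le h2 hD hD1 hm k) (hP0 k)
    rw [← average_const_mul] at h4
    exact h4.trans_eq (by ring)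
  · rw [Finset.mem_range] at hs
    exact (average_abs_le_sqrt _).trans (Real.sqrt_le_sqrt
      (average_edgeBranchMean_sub_sq_le h2 hD hm (by omega)))

/-- Markov's inequality for the configuration model. -/
lemma dcm_lt_le {f : d.Configuration → ℝ} (hf : ∀ ω, 0 ≤ f ω) {ε : ℝ} (hε : 0 < ε) :
    d.dcm {ω | ε < f ω} ≤ ENNReal.ofReal (d.average f / ε) := by
  classical
  have hN : (0 : ℝ) < Fintype.card d.Configuration := by positivity
  rw [dcm, PMF.toMeasure_uniformOfFintype_apply _ MeasurableSpace.measurableSet_top,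
    Fintype.card_subtype, ← ENNReal.ofReal_natCast, ← ENNReal.ofReal_natCast,
    ← ENNReal.ofReal_div_of_pos hN]
  refine ENNReal.ofReal_le_ofReal ?_
  rw [average, one_div_mul_eq_div, div_div, div_le_div_iff₀ hN (by positivity)]
  have h : ε * ((Finset.univ.filter fun ω => ω ∈ {ω | ε < f ω}).card : ℝ) ≤ ∑ ω, f ω := by
    calc ε * ((Finset.univ.filter fun ω => ω ∈ {ω | ε < f ω}).card : ℝ) =
        ∑ ω with ω ∈ {ω | ε < f ω}, ε := by rw [Finset.sum_const, nsmul_eq_mul, mul_comm]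
      _ ≤ ∑ ω with ω ∈ {ω | ε < f ω}, f ω :=
        Finset.sum_le_sum fun ω hω => (Finset.mem_filter.1 hω).2.le
      _ ≤ ∑ ω, f ω := Finset.sum_le_univ_sum_of_nonneg hf
  nlinarith

end BiDegreeSequence

end

theorem mainTheorem4 (d : (n : ℕ) → BiDegreeSequence n) (hd : DegreeAssumption d)
    (u : unitInterval) (hu₀ : 0 < u) (hu₁ : u < 1)
    (t : ℕ → ℝ) (ht_nonneg : ∀ n, 0 ≤ t n)
    (ht_lim : ∃ ℓ : EReal, Tendsto (fun n => (t n : EReal)) atTop (𝓝 ℓ))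
    (ht_short : t =o[atTop] fun n : ℕ => Real.log n ^ 3) :
    ∀ ε : ℝ, 0 < ε →
      Tendsto
        (fun n => (d n).dcm
          {ω | ε < |((d n).graph ω).voterExpectation u (t n)
                      ((d n).graph ω).discordantDensity
                    - 2 * (u : ℝ) * (1 - (u : ℝ)) * (d n).phi (t n)|})
        atTop (𝓝 0) := by
  intro ε hε
  obtain ⟨C, C', -, hC', hdeg⟩ := hd
  have h2 : ∀ n x, 2 ≤ (d n).outDeg x := fun n x => (hdeg n x).2.1
  set D : ℕ := ⌊C'⌋₊ with hDdef
  have hD : ∀ n x, (d n).inDeg x ≤ D := fun n x => Nat.le_floor (hdeg n x).2.2.2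
  have hD1 : 1 ≤ D := Nat.le_floor (by push_cast; linarith)
  have hedges : ∀ n, n ≤ (d n).numEdges := fun n => by
    have := BiDegreeSequence.two_mul_le_numEdges (h2 n)
    omega
  set A : (n : ℕ) → (d n).Configuration → ℝ := fun n ω =>
    |((d n).graph ω).voterExpectation u (t n) ((d n).graph ω).discordantDensity
      - 2 * (u : ℝ) * (1 - (u : ℝ)) * (d n).phi (t n)| with hA
  have hA0 : ∀ n, 0 ≤ (d n).average (A n) := fun n =>
    (BiDegreeSequence.average_const (d := d n) 0).symm.trans_le
      (BiDegreeSequence.average_mono fun ω => abs_nonneg _)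
  have hlog : ∀ k : ℕ, Tendsto (fun n : ℕ => Real.log n ^ k / n) atTop (𝓝 0) := fun k =>
    (Real.isLittleO_pow_log_id_atTop (n := k)).tendsto_div_nhds_zero.comp
      tendsto_natCast_atTop_atTop
  have ht_le : ∀ᶠ n : ℕ in atTop, t n ≤ Real.log n ^ 3 := by
    filter_upwards [ht_short.bound one_pos, eventually_ge_atTop 1] with n hn hn1
    rw [one_mul, Real.norm_eq_abs, Real.norm_eq_abs, abs_of_nonneg (ht_nonneg n),
      abs_of_nonneg (pow_nonneg (Real.log_nonneg (by exact_mod_cast hn1)) 3)] at hn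
    exact hn
  have hmean : Tendsto (fun n => (d n).average (A n)) atTop (𝓝 0) := by
    refine tendsto_order.2 ⟨fun a ha => .of_forall fun n => ha.trans_le (hA0 n), fun a ha => ?_⟩
    -- late meetings contribute at most `2 / 2 ^ S`; the rest is `O(log ^ 6 n / n + n ^ (-1 / 2))`
    obtain ⟨S, hS⟩ := exists_pow_lt_of_lt_one (show 0 < a / 4 by positivity)
      (show (1 / 2 : ℝ) < 1 by norm_num)
    have hlim : Tendsto (fun n : ℕ => 2 * (D : ℝ) * (4 * (Real.log n ^ 6 / n) +
        6 * (Real.log n ^ 3 / n) + Real.log n ^ 0 / n) + ∑ s ∈ Finset.range S,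
          √((1 + 4 * (2 * s) * (2 * (D * (2 * s + 2) + 2 * s))) / n)) atTop (𝓝 0) := by
      have h3 := ((((hlog 6).const_mul 4).add ((hlog 3).const_mul 6)).add
        (hlog 0)).const_mul (2 * (D : ℝ))
      have h4 := tendsto_finsetSum (Finset.range S) fun s _ =>
        (tendsto_const_div_atTop_nhds_zero_nat
          (1 + 4 * (2 * s) * (2 * (D * (2 * s + 2) + 2 * s)) : ℝ)).sqrt
      simpa using h3.add h4
    filter_upwards [(tendsto_order.1 hlim).2 (a / 2) (by positivity), ht_le,
      eventually_ge_atTop (4 * S + 1)] with n hn htn hnS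
    have hn0 : (0 : ℝ) < n := by exact_mod_cast (by omega : 0 < n)
    have hnm : (n : ℝ) ≤ (d n).numEdges := by exact_mod_cast hedges n
    have h5 := BiDegreeSequence.average_abs_voterExpectation_sub_le (h2 n) (hD n) hD1
      (S := S) (by have := hedges n; omega) (by have := hedges n; omega) u (ht_nonneg n)
    have h6 : 2 * D * (4 * t n ^ 2 + 6 * t n + 1) / (d n).numEdges ≤
        2 * (D : ℝ) * (4 * (Real.log n ^ 6 / n) + 6 * (Real.log n ^ 3 / n) +
          Real.log n ^ 0 / n) := by
      have h7 : t n ^ 2 ≤ Real.log n ^ 6 := by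
        rw [show (6 : ℕ) = 3 * 2 by rfl, pow_mul]
        exact pow_le_pow_left₀ (ht_nonneg n) htn 2
      have h8 := ht_nonneg n
      calc _ ≤ 2 * D * (4 * Real.log n ^ 6 + 6 * Real.log n ^ 3 + 1) / (n : ℝ) := by gcongr
        _ = _ := by ring
    have h9 : ∑ s ∈ Finset.range S,
        √((1 + 4 * (2 * s) * (2 * (D * (2 * s + 2) + 2 * s))) / (d n).numEdges : ℝ) ≤
        ∑ s ∈ Finset.range S,
          √((1 + 4 * (2 * s) * (2 * (D * (2 * s + 2) + 2 * s))) / n : ℝ) := by gcongr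
    linarith
  refine tendsto_of_tendsto_of_tendsto_of_le_of_le tendsto_const_nhds ?_
    (fun n => zero_le) fun n => BiDegreeSequence.dcm_lt_le (fun ω => abs_nonneg _) hε
  have h10 := ENNReal.tendsto_ofReal (hmean.div_const ε)
  rwa [zero_div, ENNReal.ofReal_zero] at h10
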